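/- **Theorem (Quantitative Bounds).** Let $\mathcal{M}$ be a matroid on the ground set $[m]=\{1,\dots,m\}$ of rank $n$, let $\mathcal{B}\subseteq\binom{[m]}{n}$ be its family of bases, and let $\mathcal{B}^\star=\{[m]\setminus S: S\in\mathcal{B}\}$ be the family of bases of the dual matroid $\mathcal{M}^\star$. *Definitions.* A polynomial $g\in\mathbb{R}[z_1,\dots,z_m]$ is real stable if it has no zero $z\in\mathbb{C}^m$ with $\operatorname{Im} z_i>0$ for all $i$. For $g$ with nonnegative coefficients let $g_S$ be the coefficient of $z^S=\prod_{i\in S}z_i$, $g_{\mathcal{B}}=\sum_{S\in\mathcal{B}}g_S$, and $$\mathrm{Cap}_{\mathcal{B}}(g)=\sup_{\theta\in P(\mathcal{B})}\ \inf_{z\in\mathbb{R}_{>0}^m}\frac{g(z)}{\prod_{i=1}^m z_i^{\theta_i}},\qquad P(\mathcal{B})=\mathrm{conv}\{1_S:S\in\mathcal{B}\}.$$ Let $M(\mathcal{B})$ be the supremum of $\mathrm{Cap}_{\mathcal{B}}(g)/g_{\mathcal{B}}$ over all real stable, $n$-homogeneous polynomials $g$ in $m$ variables with nonnegative coefficients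 and $g_{\mathcal{B}}>0$, and let $M_{\mathrm{lin}}(\mathcal{B})$ be the same supremum over those $g$ that are in addition multiaffine (only square-free monomials occur). A real matrix $V$ with rows $v_1,\dots,v_m$ represents a matroid on $[m]$ if, for every $S\subseteq[m]$, $S$ is independent in the matroid if and only if the family $(v_i)_{i\in S}$ is linearly independent; a matroid is $\mathbb{R}$-linear if it has such a representation. For an $\mathbb{R}$-linear matroid $\mathcal{N}$ on $[m]$ of rank $r$, $\mathrm{un}(\mathcal{N})$ is the minimum, over all representations $V\in\mathbb{R}^{m\times r}$ of $\mathcal{N}$, of $\max\{\det(V_S^\top V_S)/\det(V_T^\top V_T): S,T \text{ bases of }\mathcal{N}\}$, where $V_S$ is the submatrix of the rows of $V$ with index in $S$. *Claim.* (With the convention $0^0=1$.) 1. **Strongly Rayleigh.** Let $(p_S)_{S\in\mathcal{B}^\star}$ be a probability distribution with $p_S>0$ for every $S\in\mathcal{B}^\star$ whose generating polynomial $\sum_{S\in\mathcal{B}^\star}p_S z^S$ is real stable, and let $P=\max_{S,T\in\mathcal{B}^\star}p_S/p_T$. Then $M(\mathcal{B})\le P\cdot\frac{m^m}{m!}$ and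 $M_{\mathrm{lin}}(\mathcal{B})\le P\cdot 2^m$. 2. **Linear matroids.** If $\mathcal{M}$ is $\mathbb{R}$-linear, then $M(\mathcal{B})\le \mathrm{un}(\mathcal{M}^\star)\cdot\frac{m^m}{m!}$ and $M_{\mathrm{lin}}(\mathcal{B})\le \mathrm{un}(\mathcal{M}^\star)\cdot 2^m$. 3. **Partition matroids.** Let $P_1,\dots,P_p$ be a partition of $[m]$ into non-empty sets and $b_1,\dots,b_p$ integers with $0\le b_j\le|P_j|$, and suppose that $\mathcal{B}=\{S\subseteq[m]:|S\cap P_j|=b_j\text{ for all }j\}$. Then $$M(\mathcal{B})\le\frac{m^m}{m!}\prod_{j=1}^p\frac{(|P_j|-b_j)!}{(|P_j|-b_j)^{|P_j|-b_j}}\le e^{n+p}\left(\frac{m}{p}\right)^{p/2},\qquad M_{\mathrm{lin}}(\mathcal{B})\le\frac{n^n}{n!}\prod_{j=1}^p\frac{b_j!}{b_j^{b_j}}$$ (for $m=p=0$ the factor $(m/p)^{p/2}$ is read as $1$). -/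

import Mathlib

noncomputable section

namespace BCapacity

open scoped BigOperators

/-- The exponent vector of the square-free monomial `z^S = ∏ i ∈ S, z i`. -/
def sqfreeExp {m : ℕ} (S : Finset (Fin m)) : Fin m →₀ ℕ :=
  ∑ i ∈ S, Finsupp.single i 1

/-- The characteristic vector `1_S` of `S`. -/
def charVec {m : ℕ} (S : Finset (Fin m)) : Fin m → ℝ :=
  fun i => if i ∈ S then 1 else 0

/-- The polytope `P(B) = conv {1_S : S ∈ B}`. -/
def basePolytope {m : ℕ} (B : Finset (Finset (Fin m))) : Set (Fin m → ℝ) :=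
  convexHull ℝ {x | ∃ S ∈ B, x = charVec S}

/-- The number `g_B = ∑ S ∈ B, g_S`, with `g_S` the coefficient of `z^S` in `g`. -/
def famCoeff {m : ℕ} (B : Finset (Finset (Fin m))) (g : MvPolynomial (Fin m) ℝ) : ℝ :=
  ∑ S ∈ B, MvPolynomial.coeff (sqfreeExp S) g

/-- The `B`-capacity `sup_{θ ∈ P(B)} inf_{z > 0} g(z) / ∏ i, z i ^ θ i`. If `g` has nonnegative
coefficients then the infimum is over a set of nonnegative numbers and is at most `g(1,…,1)`, so
all bounds exist in `ℝ` (as long as `B` is non-empty). -/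
def capacity {m : ℕ} (B : Finset (Finset (Fin m))) (g : MvPolynomial (Fin m) ℝ) : ℝ :=
  ⨆ θ : basePolytope B, ⨅ z : {z : Fin m → ℝ // ∀ i, 0 < z i},
    MvPolynomial.eval z.1 g / ∏ i, (z.1 i) ^ (θ.1 i)

/-- Real stability: no zero of `g` in `ℂ^m` has all its coordinates in the open upper
half-plane. -/
def RealStable {m : ℕ} (g : MvPolynomial (Fin m) ℝ) : Prop :=
  ∀ z : Fin m → ℂ, (∀ i, 0 < (z i).im) → MvPolynomial.aeval z g ≠ 0

/-- All coefficients are nonnegative. -/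
def NonnegCoeffs {m : ℕ} (g : MvPolynomial (Fin m) ℝ) : Prop :=
  ∀ α : Fin m →₀ ℕ, 0 ≤ MvPolynomial.coeff α g

/-- Only square-free monomials occur. -/
def Multiaffine {m : ℕ} (g : MvPolynomial (Fin m) ℝ) : Prop :=
  ∀ α ∈ g.support, ∀ i, α i ≤ 1

/-- The approximation ratio `M(B)` of a family `B` of `n`-element subsets of `[m]`: the supremum
of `Cap_B(g) / g_B`, taken in the extended reals. -/
def approxRatio {m : ℕ} (n : ℕ) (B : Finset (Finset (Fin m))) : EReal :=
  sSup {r : EReal | ∃ g : MvPolynomial (Fin m) ℝ, NonnegCoeffs g ∧ RealStable g ∧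
    g.IsHomogeneous n ∧ 0 < famCoeff B g ∧ r = ((capacity B g / famCoeff B g : ℝ) : EReal)}

/-- The approximation ratio `M_lin(B)`: as `M(B)`, but over multiaffine polynomials only. -/
def approxRatioLin {m : ℕ} (n : ℕ) (B : Finset (Finset (Fin m))) : EReal :=
  sSup {r : EReal | ∃ g : MvPolynomial (Fin m) ℝ, NonnegCoeffs g ∧ Multiaffine g ∧
    RealStable g ∧ g.IsHomogeneous n ∧ 0 < famCoeff B g ∧
    r = ((capacity B g / famCoeff B g : ℝ) : EReal)}

open Classical in
/-- The family of bases of a matroid, as a finset of finsets. -/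
def bases {m : ℕ} (M : Matroid (Fin m)) : Finset (Finset (Fin m)) :=
  Finset.univ.filter (fun S => M.IsBase (S : Set (Fin m)))

/-- The generating polynomial `∑ S, μ(S) z^S` of a function on subsets of `[m]`. -/
def genPoly {m : ℕ} (μ : Finset (Fin m) → ℝ) : MvPolynomial (Fin m) ℝ :=
  ∑ S : Finset (Fin m), MvPolynomial.monomial (sqfreeExp S) (μ S)

/-- `μ` is a strongly Rayleigh probability distribution on subsets of `[m]` whose support is
exactly `B`. -/
structure IsStronglyRayleighOn {m : ℕ} (B : Finset (Finset (Fin m)))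
    (μ : Finset (Fin m) → ℝ) : Prop where
  pos : ∀ S ∈ B, 0 < μ S
  zero : ∀ S, S ∉ B → μ S = 0
  sum_eq_one : ∑ S : Finset (Fin m), μ S = 1
  stable : RealStable (genPoly μ)

/-- The real matrix `V` (one row for each element of `[m]`) represents the matroid `M`. -/
def IsRepresentation {m d : ℕ} (M : Matroid (Fin m)) (V : Matrix (Fin m) (Fin d) ℝ) : Prop :=
  ∀ S : Finset (Fin m),
    M.Indep (S : Set (Fin m)) ↔ LinearIndependent ℝ (fun i : {i // i ∈ S} => V i.1)

/-- A matroid is `ℝ`-linear if some real matrix represents it. -/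
def IsRealLinear {m : ℕ} (M : Matroid (Fin m)) : Prop :=
  ∃ (d : ℕ) (V : Matrix (Fin m) (Fin d) ℝ), IsRepresentation M V

/-- The submatrix `V_S` formed by the rows with index in `S`. -/
def rowSubmatrix {m d : ℕ} (V : Matrix (Fin m) (Fin d) ℝ) (S : Finset (Fin m)) :
    Matrix {i // i ∈ S} (Fin d) ℝ :=
  V.submatrix (fun i => i.1) id

/-- The determinant `det (V_Sᵀ V_S)`. -/
def rowDet {m d : ℕ} (V : Matrix (Fin m) (Fin d) ℝ) (S : Finset (Fin m)) : ℝ :=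
  ((rowSubmatrix V S).transpose * rowSubmatrix V S).det

/-- The unbalance of a matrix with respect to a family `B`: the largest ratio
`det (V_Sᵀ V_S) / det (V_Tᵀ V_T)` over `S, T ∈ B` (a maximum over a finite set). -/
def matrixUnbalance {m d : ℕ} (B : Finset (Finset (Fin m))) (V : Matrix (Fin m) (Fin d) ℝ) : ℝ :=
  sSup {r : ℝ | ∃ S ∈ B, ∃ T ∈ B, r = rowDet V S / rowDet V T}

/-- The unbalance of an `ℝ`-linear matroid: the least unbalance of a representation. The
representations have as many columns as the rank of the matroid; this is what makes
`det (V_Sᵀ V_S)` nonzero for the bases `S`, and any representation can be brought to this form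
by taking orthonormal coordinates on its row space, which keeps all inner products of rows. -/
def unbalance {m : ℕ} (M : Matroid (Fin m)) : ℝ :=
  sInf {r : ℝ | ∃ (d : ℕ) (V : Matrix (Fin m) (Fin d) ℝ), M.eRank = (d : ℕ∞) ∧
    IsRepresentation M V ∧ r = matrixUnbalance (bases M) V}

/-- `M` is the partition matroid `{U(P_j, b_j)}_j`: the `P_j` are non-empty and partition `[m]`,
`b_j ≤ |P_j|`, and the bases are the sets which meet each `P_j` in exactly `b_j` elements. -/
structure IsPartitionMatroid {m p : ℕ} (M : Matroid (Fin m))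
    (P : Fin p → Finset (Fin m)) (b : Fin p → ℕ) : Prop where
  nonempty : ∀ j, (P j).Nonempty
  disjoint : ∀ i j, i ≠ j → Disjoint (P i) (P j)
  cover : ∀ x, ∃ j, x ∈ P j
  le_card : ∀ j, b j ≤ (P j).card
  isBase_iff : ∀ S : Finset (Fin m),
    M.IsBase (S : Set (Fin m)) ↔ ∀ j, (S ∩ P j).card = b j

end BCapacity

end


/-!
Gurvits's theorem bounds the coefficient of `z_1 ⋯ z_m` in a real stable homogeneous polynomial of
degree `m` from below by its capacity at the exponent `(1, …, 1)`: variables are eliminated one at a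
time, and a real-rooted polynomial in one variable with nonpositive roots loses at most the factor
`((k - 1) / k) ^ (k - 1)`, by the inequality of the means. A sum of coefficients `g_B` becomes a
single coefficient after multiplication by a stable *selector* polynomial, whose square-free
monomials are the complements of the members of `B`; the capacity of the product is at least the
product of the capacities. The selectors are the generating polynomial of a strongly Rayleigh
distribution on the dual bases, the polynomial `det (Wᵀ diag(z) W)` of a representation `W` of the
dual matroid, which enumerates its bases by the Cauchy–Binet formula, and, for partition matroids,
the product of powers of the block sums. For multiaffine polynomials and partition matroids one
replaces instead every variable by an average of new variables, `b_j` of them for the block `P_j`,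
which again turns `g_B` into a multiple of one coefficient.
-/

noncomputable section

namespace BCapacity

open Filter Topology

section Univariate

open Polynomial

lemma le_of_forall_pos_mul_le_add {a b c : ℝ} (h : ∀ t > 0, c * t ≤ a + b * t) : c ≤ b := by
  by_contra! hbc
  have hcb : 0 < c - b := sub_pos.2 hbc
  have ht := h ((|a| + 1) / (c - b)) (by positivity)
  have hmul : (c - b) * ((|a| + 1) / (c - b)) = |a| + 1 := mul_div_cancel₀ _ hcb.ne'
  linarith [le_abs_self a]

lemma multiset_prod_le_pow_card {A : Multiset ℝ} (hA : ∀ a ∈ A, 0 ≤ a) :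
    A.prod ≤ (A.sum / A.card) ^ A.card := by
  classical
  rcases A.card.eq_zero_or_pos with h0 | h0
  · simp [Multiset.card_eq_zero.1 h0]
  have hcard : (0 : ℝ) < A.card := by exact_mod_cast h0
  have hnonneg : ∀ x : A, 0 ≤ (x : ℝ) := fun x => hA _ (Multiset.coe_mem)
  have amgm := Real.geom_mean_le_arith_mean Finset.univ (fun _ : A => 1) (fun x => (x : ℝ))
    (fun _ _ => zero_le_one) (by simpa using hcard) (fun x _ => hnonneg x)
  simp only [Real.rpow_one, Finset.sum_const, Finset.card_univ, Multiset.card_coe, nsmul_eq_mul,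
    mul_one, one_mul, ← Multiset.prod_eq_prod_coe, ← Multiset.sum_eq_sum_coe] at amgm
  calc A.prod = (A.prod ^ (A.card : ℝ)⁻¹) ^ A.card :=
        (Real.rpow_inv_natCast_pow (Multiset.prod_nonneg hA) h0.ne').symm
    _ ≤ _ := pow_le_pow_left₀ (Real.rpow_nonneg (Multiset.prod_nonneg hA) _) amgm _

lemma multiset_prod_one_add_le_pow {A : Multiset ℝ} (hA : ∀ a ∈ A, 0 ≤ a) {k : ℕ} (hk : 1 ≤ k)
    (hAk : A.card ≤ k) : (A.map (1 + ·)).prod ≤ (1 + A.sum / k) ^ k := by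
  obtain ⟨d, rfl⟩ := Nat.exists_eq_add_of_le hAk
  have h := multiset_prod_le_pow_card (A := A.map (1 + ·) + Multiset.replicate d 1) fun b hb => by
    rcases Multiset.mem_add.1 hb with hb | hb
    · obtain ⟨a, ha, rfl⟩ := Multiset.mem_map.1 hb
      exact add_nonneg zero_le_one (hA a ha)
    · exact (Multiset.eq_of_mem_replicate hb).symm ▸ zero_le_one
  have hk0 : (A.card + d : ℝ) ≠ 0 := by exact_mod_cast (by omega : A.card + d ≠ 0)
  have hmean : ((A.map (1 + ·)).sum + d) / (A.card + d : ℝ) = 1 + A.sum / (A.card + d : ℝ) := by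
    rw [Multiset.sum_map_add (f := fun _ => 1) (g := fun a => a)]
    simp only [Multiset.map_const', Multiset.sum_replicate, nsmul_eq_mul, mul_one, Multiset.map_id']
    field_simp
    ring
  simpa [hmean] using h

lemma eval_eq_eval_zero_mul_prod_roots {K : Type*} [Field K] {R : K[X]} (hR : R.Splits)
    (h0 : R.eval 0 ≠ 0) (t : K) :
    R.eval t = R.eval 0 * (R.roots.map (fun r => 1 - t / r)).prod := by
  rw [hR.eval_eq_prod_roots t, hR.eval_eq_prod_roots 0, mul_assoc, ← Multiset.prod_map_mul]
  congr 2
  refine Multiset.map_congr rfl fun r hr => ?_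
  have hr0 : r ≠ 0 := by
    rintro rfl
    exact h0 (isRoot_of_mem_roots hr)
  field_simp
  ring

lemma coeff_one_eq_eval_zero_mul_sum_roots {K : Type*} [Field K] {R : K[X]} (hR : R.Splits)
    (h0 : R.eval 0 ≠ 0) : R.coeff 1 = R.eval 0 * (R.roots.map (fun r => -r⁻¹)).sum := by
  have h := hR.eval_derivative_eq_eval_mul_sum h0
  rw [← coeff_zero_eq_eval_zero, coeff_derivative] at h
  simpa using h

lemma tendsto_eval_div_nhdsGT_zero {𝕜 : Type*} [RCLike 𝕜] {R : 𝕜[X]} (h0 : R.eval 0 = 0) :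
    Tendsto (fun t : ℝ => R.eval (t : 𝕜) / t) (𝓝[>] 0) (𝓝 (R.coeff 1)) := by
  have hX : R = R.divX * X := by
    have h := R.divX_mul_X_add
    rwa [coeff_zero_eq_eval_zero, h0, C_0, add_zero, eq_comm] at h
  have hlim : Tendsto (fun t : ℝ => R.divX.eval (t : 𝕜)) (𝓝[>] 0) (𝓝 (R.coeff 1)) := by
    have hcont : Continuous fun t : ℝ => R.divX.eval (t : 𝕜) :=
      R.divX.continuous.comp RCLike.continuous_ofReal
    refine (hcont.tendsto' 0 _ ?_).mono_left nhdsWithin_le_nhds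
    rw [RCLike.ofReal_zero, ← coeff_zero_eq_eval_zero, coeff_divX]
  refine hlim.congr' ?_
  filter_upwards [self_mem_nhdsWithin] with t (ht : 0 < t)
  have ht0 : (t : 𝕜) ≠ 0 := RCLike.ofReal_ne_zero.2 ht.ne'
  conv_rhs => rw [hX, eval_mul, eval_X, mul_div_cancel_right₀ _ ht0]

lemma norm_eval_zero_le_norm_eval_one {R : ℂ[X]} (hR : ∀ r, R.eval r = 0 → r.re = 0) :
    ‖R.eval 0‖ ≤ ‖R.eval 1‖ := by
  by_cases h0 : R.eval 0 = 0
  · simp [h0]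
  rw [eval_eq_eval_zero_mul_prod_roots (IsAlgClosed.splits R) h0 1, norm_mul]
  refine le_mul_of_one_le_right (norm_nonneg _) ?_
  refine Multiset.prod_induction (fun w : ℂ => 1 ≤ ‖w‖) _ (fun v w hv hw => ?_) (by simp) ?_
  · rw [norm_mul]
    exact one_le_mul_of_one_le_of_one_le hv hw
  · simp only [Multiset.mem_map, forall_exists_index, and_imp]
    rintro _ r hr rfl
    have hre : (1 - 1 / r).re = 1 := by simp [Complex.inv_re, hR r (isRoot_of_mem_roots hr)]
    calc (1 : ℝ) = |(1 - 1 / r).re| := by rw [hre, abs_one]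
      _ ≤ ‖1 - 1 / r‖ := Complex.abs_re_le_norm _

lemma coeff_one_ne_zero_of_roots_re_neg {R : ℂ[X]} {c : ℝ} (hc : 0 < c)
    (hR : ∀ r, R.eval r = 0 → r = 0 ∨ r.re < 0) (hge : ∀ t : ℝ, 0 < t → c * t ≤ ‖R.eval (t : ℂ)‖) :
    R.coeff 1 ≠ 0 := by
  by_cases h0 : R.eval 0 = 0
  · have hlim := (tendsto_eval_div_nhdsGT_zero h0).norm
    have hle : c ≤ ‖R.coeff 1‖ := by
      refine ge_of_tendsto hlim ?_
      filter_upwards [self_mem_nhdsWithin] with t (ht : 0 < t)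
      rw [norm_div, RCLike.norm_ofReal, abs_of_pos ht, le_div_iff₀ ht]
      exact hge t ht
    exact norm_pos_iff.1 (hc.trans_le hle)
  have hroots : R.roots ≠ 0 := by
    intro hr
    have hconst : ∀ t : ℂ, R.eval t = R.eval 0 := fun t => by
      rw [eval_eq_eval_zero_mul_prod_roots (IsAlgClosed.splits R) h0 t, hr]
      simp
    refine hc.not_ge (le_of_forall_pos_mul_le_add (a := ‖R.eval 0‖) fun t ht => ?_)
    simpa [hconst] using hge t ht
  rw [coeff_one_eq_eval_zero_mul_sum_roots (IsAlgClosed.splits R) h0]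
  have hpos : 0 < (R.roots.map fun r => -r⁻¹).sum.re := by
    refine Multiset.sum_induction_nonempty (fun z : ℂ => 0 < z.re)
      (fun _ _ => add_pos) (mt Multiset.map_eq_zero.1 hroots) ?_
    simp only [Multiset.mem_map, forall_exists_index, and_imp]
    rintro _ r hr rfl
    have hr_root : R.eval r = 0 := isRoot_of_mem_roots hr
    have hr0 : r ≠ 0 := fun h => h0 (h ▸ hr_root)
    rw [Complex.neg_re, Complex.inv_re, ← neg_div]
    exact div_pos (neg_pos.2 ((hR r hr_root).resolve_left hr0)) (Complex.normSq_pos.2 hr0)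
  exact mul_ne_zero h0 fun hsum => hpos.ne' (by rw [hsum, Complex.zero_re])

/-- The factor `((k - 1) / k) ^ (k - 1)` by which Gurvits's theorem lowers the capacity when
a variable of degree at most `k` is eliminated; it is `1` for `k ≤ 1`. -/
def gurvitsFactor (k : ℕ) : ℝ := (((k - 1 : ℕ) : ℝ) / k) ^ (k - 1)

lemma gurvitsFactor_nonneg (k : ℕ) : 0 ≤ gurvitsFactor k := by
  unfold gurvitsFactor
  positivity

lemma gurvitsFactor_le_one (k : ℕ) : gurvitsFactor k ≤ 1 :=
  pow_le_one₀ (by positivity) (div_le_one_of_le₀ (by gcongr; exact k.sub_le 1) (by positivity))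

lemma gurvitsFactor_pos {k : ℕ} (hk : 1 ≤ k) : 0 < gurvitsFactor k := by
  unfold gurvitsFactor
  rcases hk.eq_or_lt with rfl | h
  · simp
  · have : 0 < k - 1 := by omega
    positivity

lemma mul_gurvitsFactor_le_of_forall_mul_le_pow {a c s : ℝ} {k : ℕ} (hk : 1 ≤ k) (hs : 0 ≤ s)
    (h : ∀ t > 0, c * t ≤ a * (1 + s * t / k) ^ k) : c * gurvitsFactor k ≤ a * s := by
  obtain ⟨j, rfl⟩ : ∃ j, k = j + 1 := ⟨k - 1, by omega⟩
  rcases hs.eq_or_lt with rfl | hs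
  · have hc : c ≤ 0 := le_of_forall_pos_mul_le_add (a := a) fun t ht => by simpa using h t ht
    rw [mul_zero]
    exact mul_nonpos_of_nonpos_of_nonneg hc (gurvitsFactor_nonneg _)
  rcases j.eq_zero_or_pos with rfl | hj
  · have hc : c ≤ a * s := le_of_forall_pos_mul_le_add (a := a) fun t ht => by
      simpa [mul_add, mul_assoc] using h t ht
    simpa [gurvitsFactor] using hc
  have : (0 : ℝ) < j := by exact_mod_cast hj
  -- the minimizer of `(1 + s * t / k) ^ k / t`
  have ht := h ((j + 1) / (s * j)) (by positivity)
  have hbase : 1 + s * ((j + 1) / (s * j)) / ((j + 1 : ℕ) : ℝ) = ((j : ℝ) / (j + 1))⁻¹ := by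
    push_cast
    field_simp
  rw [hbase] at ht
  have hfactor : gurvitsFactor (j + 1) = ((j : ℝ) / (j + 1)) ^ j := by simp [gurvitsFactor]
  calc c * gurvitsFactor (j + 1)
      = c * ((j + 1) / (s * j)) * (s * ((j : ℝ) / (j + 1)) ^ (j + 1)) := by
        rw [hfactor, pow_succ]
        field_simp
    _ ≤ a * ((j : ℝ) / (j + 1))⁻¹ ^ (j + 1) * (s * ((j : ℝ) / (j + 1)) ^ (j + 1)) := by gcongr
    _ = a * s := by
        rw [inv_pow]
        field_simp

lemma mul_gurvitsFactor_le_coeff_one {R : ℝ[X]} (hR : R.Splits) (hroots : ∀ r ∈ R.roots, r ≤ 0)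
    {c : ℝ} (hc : 0 ≤ c) (hge : ∀ t : ℝ, 0 < t → c * t ≤ R.eval t) {k : ℕ} (hk : 1 ≤ k)
    (hdeg : R.natDegree ≤ k) : c * gurvitsFactor k ≤ R.coeff 1 := by
  have h0 : 0 ≤ R.eval 0 := by
    refine ge_of_tendsto
      ((R.continuous.tendsto 0).mono_left (nhdsWithin_le_nhds (s := Set.Ioi 0))) ?_
    filter_upwards [self_mem_nhdsWithin] with t (ht : 0 < t)
    exact (mul_nonneg hc ht.le).trans (hge t ht)
  rcases h0.eq_or_lt with h0 | h0
  · refine (mul_le_of_le_one_right hc (gurvitsFactor_le_one k)).trans ?_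
    refine ge_of_tendsto (tendsto_eval_div_nhdsGT_zero h0.symm) ?_
    filter_upwards [self_mem_nhdsWithin] with t (ht : 0 < t)
    exact (le_div_iff₀ ht).2 (hge t ht)
  have hnonneg : ∀ a ∈ R.roots.map (fun r => -r⁻¹), 0 ≤ a := by
    simp only [Multiset.mem_map, forall_exists_index, and_imp]
    rintro _ r hr rfl
    exact neg_nonneg.2 (inv_nonpos.2 (hroots r hr))
  rw [coeff_one_eq_eval_zero_mul_sum_roots hR h0.ne']
  refine mul_gurvitsFactor_le_of_forall_mul_le_pow hk (Multiset.sum_nonneg hnonneg)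
    fun t ht => (hge t ht).trans ?_
  rw [eval_eq_eval_zero_mul_prod_roots hR h0.ne' t, ← Multiset.sum_map_mul_right]
  gcongr
  have hcard : (R.roots.map fun r => -r⁻¹ * t).card ≤ k := by
    rw [Multiset.card_map]
    exact R.card_roots'.trans hdeg
  have hprod := multiset_prod_one_add_le_pow (A := R.roots.map fun r => -r⁻¹ * t) ?_ hk hcard
  · simpa [Multiset.map_map, Function.comp_def, div_eq_inv_mul, sub_eq_add_neg] using hprod
  · simp only [Multiset.mem_map, forall_exists_index, and_imp]
    rintro _ r hr rfl
    exact mul_nonneg (neg_nonneg.2 (inv_nonpos.2 (hroots r hr))) ht.le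

end Univariate

open MvPolynomial

section HurwitzStable

variable {σ : Type*} {f g : MvPolynomial σ ℝ} {d : ℕ}

/-- The polynomial `f` has no zero all of whose coordinates have positive real part. For
homogeneous `f` this is real stability, as is seen by rotating all variables by a right angle. -/
def HurwitzStable (f : MvPolynomial σ ℝ) : Prop :=
  ∀ z : σ → ℂ, (∀ i, 0 < (z i).re) → aeval z f ≠ 0

lemma HurwitzStable.mul (hf : HurwitzStable f) (hg : HurwitzStable g) : HurwitzStable (f * g) := by
  intro z hz
  rw [map_mul]
  exact mul_ne_zero (hf z hz) (hg z hz)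

lemma aeval_ofReal (f : MvPolynomial σ ℝ) (x : σ → ℝ) :
    aeval (fun i => (x i : ℂ)) f = ((eval x f : ℝ) : ℂ) := by
  simpa [Function.comp_def] using aeval_algebraMap_apply ℂ x f

lemma aeval_const_mul_of_isHomogeneous {R A : Type*} [CommSemiring R] [CommSemiring A]
    [Algebra R A] {f : MvPolynomial σ R} (hf : f.IsHomogeneous d) (c : A) (z : σ → A) :
    aeval (fun i => c * z i) f = c ^ d * aeval z f := by
  rw [aeval_def, aeval_def, eval₂_eq, eval₂_eq, Finset.mul_sum]
  refine Finset.sum_congr rfl fun α hα => ?_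
  simp_rw [mul_pow, Finset.prod_mul_distrib, Finset.prod_pow_eq_pow_sum]
  rw [← hf.degree_eq_sum_deg_support hα, mul_left_comm]

lemma continuous_aeval (f : MvPolynomial σ ℝ) : Continuous fun z : σ → ℂ => aeval z f := by
  simpa only [aeval_def, ← eval_map] using continuous_eval (map (algebraMap ℝ ℂ) f)

lemma RealStable.hurwitzStable {m : ℕ} {f : MvPolynomial (Fin m) ℝ} (hf : RealStable f)
    (hd : f.IsHomogeneous d) : HurwitzStable f := by
  intro z hz h0
  refine hf (fun i => Complex.I * z i) (fun i => by simpa using hz i) ?_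
  rw [aeval_const_mul_of_isHomogeneous hd, h0, mul_zero]

namespace HurwitzStable

lemma exists_re_mul_nonpos (hf : HurwitzStable f) (hd : f.IsHomogeneous d) {w : σ → ℂ}
    (hw : aeval w f = 0) (c : ℂ) : ∃ i, (c * w i).re ≤ 0 := by
  by_contra! hpos
  exact hf _ hpos (by rw [aeval_const_mul_of_isHomogeneous hd, hw, mul_zero])

lemma abs_eval_re_le_norm_aeval_of_pos (hf : HurwitzStable f) (hd : f.IsHomogeneous d) {z : σ → ℂ}
    (hz : ∀ i, 0 < (z i).re) : |eval (fun i => (z i).re) f| ≤ ‖aeval z f‖ := by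
  set line : ℂ → σ → ℂ := fun s i => (z i).re + Complex.I * (z i).im * s with hline
  set R : Polynomial ℂ := aeval (fun i => Polynomial.C ((z i).re : ℂ) +
    Polynomial.C (Complex.I * (z i).im) * Polynomial.X) f with hR
  have hR_eval : ∀ s, R.eval s = aeval (line s) f := fun s => by
    rw [hR, ← Polynomial.coe_aeval_eq_eval]
    have h := comp_aeval_apply (R := ℝ) (f := fun i => Polynomial.C ((z i).re : ℂ) +
      Polynomial.C (Complex.I * (z i).im) * Polynomial.X)
      ((Polynomial.aeval s).restrictScalars ℝ) f
    simpa [hline] using h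
  have hroots : ∀ s, R.eval s = 0 → s.re = 0 := by
    intro s hs
    rw [hR_eval] at hs
    have hre : ∀ i, ((starRingEnd ℂ) s * line s i).re = (z i).re * s.re := fun i => by
      simp only [hline, Complex.mul_re, Complex.mul_im, Complex.add_re, Complex.add_im,
        Complex.conj_re, Complex.conj_im, Complex.ofReal_re, Complex.ofReal_im, Complex.I_re,
        Complex.I_im]
      ring
    obtain ⟨i, hi⟩ := hf.exists_re_mul_nonpos hd hs ((starRingEnd ℂ) s)
    obtain ⟨j, hj⟩ := hf.exists_re_mul_nonpos hd hs (-(starRingEnd ℂ) s)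
    rw [hre] at hi
    rw [neg_mul, Complex.neg_re, hre, neg_nonpos] at hj
    exact le_antisymm (nonpos_of_mul_nonpos_right hi (hz i)) (nonneg_of_mul_nonneg_right hj (hz j))
  have h0 : line 0 = fun i => (((z i).re : ℝ) : ℂ) := by simp [hline]
  have h1 : line 1 = z := by
    funext i
    simp [hline, mul_comm Complex.I]
  simpa [hR_eval, h0, h1, aeval_ofReal] using norm_eval_zero_le_norm_eval_one hroots

lemma abs_eval_re_le_norm_aeval (hf : HurwitzStable f) (hd : f.IsHomogeneous d) {z : σ → ℂ}
    (hz : ∀ i, 0 ≤ (z i).re) : |eval (fun i => (z i).re) f| ≤ ‖aeval z f‖ := by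
  have hleft : Continuous fun ε : ℝ => |eval (fun i => (z i + ε).re) f| := by
    simp only [Complex.add_re, Complex.ofReal_re]
    exact ((continuous_eval f).comp (by fun_prop)).abs
  have hright : Continuous fun ε : ℝ => ‖aeval (fun i => z i + (ε : ℂ)) f‖ :=
    ((continuous_aeval f).comp (by fun_prop)).norm
  refine le_of_tendsto_of_tendsto
    ((hleft.tendsto' 0 _ (by simp)).mono_left (nhdsWithin_le_nhds (s := Set.Ioi 0)))
    ((hright.tendsto' 0 _ (by simp)).mono_left nhdsWithin_le_nhds) ?_
  filter_upwards [self_mem_nhdsWithin] with ε (hε : 0 < ε)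
  exact hf.abs_eval_re_le_norm_aeval_of_pos hd fun i => by
    simpa using add_pos_of_nonneg_of_pos (hz i) hε

variable {n : ℕ} {f : MvPolynomial (Fin (n + 1)) ℝ}

lemma eq_zero_or_re_neg_of_aeval_cons_eq_zero (hf : HurwitzStable f) (hd : f.IsHomogeneous d)
    {z : Fin n → ℂ} (hz : ∀ i, 0 < (z i).re) {t : ℂ}
    (ht : aeval (Fin.cons t z : Fin (n + 1) → ℂ) f = 0) : t = 0 ∨ t.re < 0 := by
  by_contra! hcon
  obtain ⟨ht0, htre⟩ := hcon
  -- a small rotation towards `conj t` puts `t` in the right half-plane and keeps `z` there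
  have hev : ∀ᶠ ε : ℝ in 𝓝[>] 0, ∀ i, 0 < ((1 + ε * (starRingEnd ℂ) t) * z i).re := by
    refine eventually_all.2 fun i => ?_
    have hcont : Continuous fun ε : ℝ => ((1 + (ε : ℂ) * (starRingEnd ℂ) t) * z i).re := by
      fun_prop
    exact ((hcont.tendsto' 0 (z i).re (by simp)).mono_left nhdsWithin_le_nhds).eventually_const_lt
      (hz i)
  obtain ⟨ε, hε_z, hε : 0 < ε⟩ := (hev.and self_mem_nhdsWithin).exists
  obtain ⟨i, hi⟩ := hf.exists_re_mul_nonpos hd ht (1 + ε * (starRingEnd ℂ) t)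
  cases i using Fin.cases with
  | succ j => exact (hε_z j).not_ge hi
  | zero =>
    have hrot : ((1 + ε * (starRingEnd ℂ) t) * t).re = t.re + ε * Complex.normSq t := by
      simp only [Complex.mul_re, Complex.mul_im, Complex.add_re, Complex.add_im, Complex.one_re,
        Complex.one_im, Complex.ofReal_re, Complex.ofReal_im, Complex.conj_re, Complex.conj_im,
        Complex.normSq_apply]
      ring
    rw [Fin.cons_zero, hrot] at hi
    have hpos : 0 < ε * Complex.normSq t := mul_pos hε (Complex.normSq_pos.2 ht0)
    linarith

lemma eq_neg_norm_of_aeval_cons_eq_zero (hf : HurwitzStable f) (hd : f.IsHomogeneous d)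
    {x : Fin n → ℝ} (hx : ∀ i, 0 < x i) {t : ℂ}
    (ht : aeval (Fin.cons t (fun i => (x i : ℂ)) : Fin (n + 1) → ℂ) f = 0) :
    t = ((-‖t‖ : ℝ) : ℂ) := by
  -- `‖t‖ + conj t` halves the angle between `t` and the positive reals
  have hre_nonpos : ‖t‖ + t.re ≤ 0 := by
    obtain ⟨i, hi⟩ := hf.exists_re_mul_nonpos hd ht (‖t‖ + (starRingEnd ℂ) t)
    cases i using Fin.cases with
    | succ j =>
      rw [Fin.cons_succ, Complex.re_mul_ofReal] at hi
      simpa using nonpos_of_mul_nonpos_left hi (hx j)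
    | zero =>
      have hrot : ((‖t‖ + (starRingEnd ℂ) t) * t).re = ‖t‖ * (‖t‖ + t.re) := by
        have hnorm := Complex.normSq_eq_norm_sq t
        rw [Complex.normSq_apply] at hnorm
        simp only [Complex.mul_re, Complex.add_re, Complex.add_im, Complex.ofReal_re,
          Complex.ofReal_im, Complex.conj_re, Complex.conj_im]
        linear_combination hnorm
      rw [Fin.cons_zero, hrot] at hi
      rcases (norm_nonneg t).eq_or_lt with h0 | h0
      · simp [norm_eq_zero.1 h0.symm]
      · exact nonpos_of_mul_nonpos_right hi h0
  have hre : t.re = -‖t‖ := by linarith [(abs_le.1 (Complex.abs_re_le_norm t)).1]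
  have him : t.im = 0 := Complex.abs_re_eq_norm.1 (by rw [hre, abs_neg, abs_norm])
  exact Complex.ext hre him

end HurwitzStable

end HurwitzStable

section Gurvits

/-- The inequality `c ≤ inf_{z > 0} f(z) / ∏ i, z i ^ θ i`, stated without the infimum: the capacity
of `f` at the exponent `θ` is at least `c`. -/
def CapacityGE {σ : Type*} [Fintype σ] (f : MvPolynomial σ ℝ) (θ : σ → ℝ) (c : ℝ) : Prop :=
  ∀ z : σ → ℝ, (∀ i, 0 < z i) → c * ∏ i, z i ^ θ i ≤ eval z f

/-- The polynomial `f(T, z)` in the single variable `T`, from which Gurvits's theorem eliminates one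
variable at a time. -/
def fiberPoly {A : Type*} [CommRing A] [Algebra ℝ A] {n : ℕ} (f : MvPolynomial (Fin (n + 1)) ℝ)
    (z : Fin n → A) : Polynomial A :=
  (finSuccEquiv ℝ n f).map (aeval z : MvPolynomial (Fin n) ℝ →ₐ[ℝ] A).toRingHom

section FiberPoly

variable {A : Type*} [CommRing A] [Algebra ℝ A] {n : ℕ} (f : MvPolynomial (Fin (n + 1)) ℝ)
  (z : Fin n → A)

lemma eval_fiberPoly (t : A) :
    (fiberPoly f z).eval t = aeval (Fin.cons t z : Fin (n + 1) → A) f := by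
  induction f using MvPolynomial.induction_on with
  | C a => simp [fiberPoly, finSuccEquiv_apply]
  | add p q hp hq => simpa [fiberPoly] using congr_arg₂ (· + ·) hp hq
  | mul_X p i hp =>
    have hX : (fiberPoly (X i) z).eval t = (Fin.cons t z : Fin (n + 1) → A) i := by
      cases i using Fin.cases <;> simp [fiberPoly, finSuccEquiv_X_zero, finSuccEquiv_X_succ]
    rw [map_mul, aeval_X, ← hp, ← hX]
    simp [fiberPoly]

lemma coeff_fiberPoly (j : ℕ) :
    (fiberPoly f z).coeff j = aeval z ((finSuccEquiv ℝ n f).coeff j) := by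
  simp [fiberPoly]

lemma natDegree_fiberPoly_le : (fiberPoly f z).natDegree ≤ degreeOf 0 f :=
  Polynomial.natDegree_map_le.trans (natDegree_finSuccEquiv f).le

lemma map_fiberPoly_ofReal (x : Fin n → ℝ) :
    (fiberPoly f x).map (algebraMap ℝ ℂ) = fiberPoly f fun i => (x i : ℂ) := by
  rw [fiberPoly, fiberPoly, Polynomial.map_map]
  congr 1
  ext p
  · simp
  · simp

end FiberPoly

namespace HurwitzStable

variable {n d : ℕ} {f : MvPolynomial (Fin (n + 1)) ℝ} {c : ℝ}

lemma coeff_one_finSuccEquiv (hf : HurwitzStable f) (hd : f.IsHomogeneous d) (hc : 0 < c)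
    (hcap : CapacityGE f 1 c) : HurwitzStable ((finSuccEquiv ℝ n f).coeff 1) := by
  intro z hz
  rw [← coeff_fiberPoly]
  refine coeff_one_ne_zero_of_roots_re_neg (c := c * ∏ i, (z i).re)
    (mul_pos hc (Finset.prod_pos fun i _ => hz i)) (fun r hr => ?_) fun t ht => ?_
  · exact hf.eq_zero_or_re_neg_of_aeval_cons_eq_zero hd hz ((eval_fiberPoly f z r).symm.trans hr)
  have hpos : ∀ i, 0 < ((Fin.cons (t : ℂ) z : Fin (n + 1) → ℂ) i).re :=
    Fin.cases (by simpa using ht) (by simpa using hz)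
  calc c * (∏ i, (z i).re) * t
      = c * ∏ i, ((Fin.cons (t : ℂ) z : Fin (n + 1) → ℂ) i).re ^ (1 : Fin (n + 1) → ℝ) i := by
        simp [Fin.prod_univ_succ]
        ring
    _ ≤ eval (fun i => ((Fin.cons (t : ℂ) z : Fin (n + 1) → ℂ) i).re) f := hcap _ hpos
    _ ≤ ‖(fiberPoly f z).eval (t : ℂ)‖ := by
        rw [eval_fiberPoly]
        exact (le_abs_self _).trans (hf.abs_eval_re_le_norm_aeval_of_pos hd hpos)

lemma capacityGE_coeff_one_finSuccEquiv (hf : HurwitzStable f) (hd : f.IsHomogeneous d)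
    (hc : 0 ≤ c) (hcap : CapacityGE f 1 c) {k : ℕ} (hk : 1 ≤ k) (hdeg : degreeOf 0 f ≤ k) :
    CapacityGE ((finSuccEquiv ℝ n f).coeff 1) 1 (c * gurvitsFactor k) := by
  intro x hx
  have hroots : ∀ r : ℂ, ((fiberPoly f x).map (algebraMap ℝ ℂ)).eval r = 0 →
      r = ((-‖r‖ : ℝ) : ℂ) := fun r hr => by
    rw [map_fiberPoly_ofReal, eval_fiberPoly] at hr
    exact hf.eq_neg_norm_of_aeval_cons_eq_zero hd hx hr
  have hsplits : (fiberPoly f x).Splits :=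
    Polynomial.Splits.of_splits_map (algebraMap ℝ ℂ) (IsAlgClosed.splits _) fun r hr =>
      ⟨-‖r‖, (hroots r (Polynomial.isRoot_of_mem_roots hr)).symm⟩
  have hnonpos : ∀ r ∈ (fiberPoly f x).roots, r ≤ 0 := fun r hr => by
    have h := hroots r (by
      rw [← Complex.coe_algebraMap, Polynomial.eval_map_apply,
        Polynomial.isRoot_of_mem_roots hr, map_zero])
    have hr : r = -‖(r : ℂ)‖ := by exact_mod_cast h
    rw [hr]
    exact neg_nonpos.2 (norm_nonneg _)
  have hge : ∀ t : ℝ, 0 < t → c * (∏ i, x i) * t ≤ (fiberPoly f x).eval t := fun t ht => by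
    have h := hcap (Fin.cons t x) (Fin.cases (by simpa using ht) (by simpa using hx))
    rw [eval_fiberPoly, aeval_eq_eval]
    simpa [Fin.prod_univ_succ, mul_comm, mul_left_comm, mul_assoc] using h
  have hcoeff := mul_gurvitsFactor_le_coeff_one hsplits hnonpos
    (mul_nonneg hc (Finset.prod_nonneg fun i _ => (hx i).le)) hge hk
    ((natDegree_fiberPoly_le f x).trans hdeg)
  simpa [coeff_fiberPoly, mul_right_comm, aeval_eq_eval] using hcoeff

end HurwitzStable

lemma sqfreeExp_apply {m : ℕ} (S : Finset (Fin m)) (i : Fin m) :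
    sqfreeExp S i = if i ∈ S then 1 else 0 := by
  simp [sqfreeExp, Finsupp.finsetSum_apply, Finsupp.single_apply]

lemma cons_one_sqfreeExp_univ (n : ℕ) :
    (sqfreeExp (Finset.univ : Finset (Fin n))).cons 1 = sqfreeExp Finset.univ := by
  ext i
  cases i using Fin.cases <;> simp [sqfreeExp_apply]

lemma prod_gurvitsFactor (m : ℕ) :
    ∏ i ∈ Finset.range m, gurvitsFactor (i + 1) = (m.factorial : ℝ) / (m : ℝ) ^ m := by
  induction m with
  | zero => simp
  | succ n ih =>
    rw [Finset.prod_range_succ, ih, gurvitsFactor, Nat.factorial_succ, Nat.add_sub_cancel]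
    have hn : (n : ℝ) ^ n ≠ 0 := by exact_mod_cast Nat.pow_self_pos.ne'
    push_cast
    rw [div_pow]
    field_simp
    exact pow_succ' _ _

lemma one_half_pow_le_prod_gurvitsFactor (m : ℕ) :
    (1 / 2 : ℝ) ^ m ≤ ∏ i ∈ Finset.range m, gurvitsFactor (min (i + 1) 2) := by
  rw [← Finset.card_range m, ← Finset.prod_const, Finset.card_range]
  refine Finset.prod_le_prod (fun i _ => by norm_num) fun i _ => ?_
  rcases i with _ | i
  · norm_num [gurvitsFactor]
  · rw [min_eq_right (by omega)]
    norm_num [gurvitsFactor]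

namespace HurwitzStable

theorem mul_prod_gurvitsFactor_le_coeff {m κ : ℕ} (hκ : 1 ≤ κ) {f : MvPolynomial (Fin m) ℝ}
    {c : ℝ} (hf : HurwitzStable f) (hd : f.IsHomogeneous m) (hc : 0 < c)
    (hcap : CapacityGE f 1 c) (hdeg : ∀ i, degreeOf i f ≤ κ) :
    c * ∏ i ∈ Finset.range m, gurvitsFactor (min (i + 1) κ) ≤
      coeff (sqfreeExp Finset.univ) f := by
  induction m generalizing c with
  | zero =>
    have hconst : f = C (coeff 0 f) := totalDegree_eq_zero_iff_eq_C.1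
      ((totalDegree_zero_iff_isHomogeneous _).2 hd)
    have h := hcap Fin.elim0 fun i => i.elim0
    rw [hconst] at h
    simpa [sqfreeExp] using h
  | succ n ih =>
    have hk : 1 ≤ min (n + 1) κ := le_min (by omega) hκ
    have hdeg0 : degreeOf 0 f ≤ min (n + 1) κ :=
      le_min ((degreeOf_le_totalDegree f 0).trans hd.totalDegree_le) (hdeg 0)
    have h := ih (hf.coeff_one_finSuccEquiv hd hc hcap)
      (hd.finSuccEquiv_coeff_isHomogeneous 1 n (by omega)) (mul_pos hc (gurvitsFactor_pos hk))
      (hf.capacityGE_coeff_one_finSuccEquiv hd hc.le hcap hk hdeg0)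
      fun i => (degreeOf_coeff_finSuccEquiv f i 1).trans (hdeg _)
    rw [finSuccEquiv_coeff_coeff, cons_one_sqfreeExp_univ] at h
    rwa [Finset.prod_range_succ, mul_comm (∏ i ∈ _, _), ← mul_assoc]

variable {m : ℕ} {f : MvPolynomial (Fin m) ℝ} {c : ℝ}

theorem le_mul_coeff (hf : HurwitzStable f) (hd : f.IsHomogeneous m) (hc : 0 < c)
    (hcap : CapacityGE f 1 c) :
    c ≤ (m : ℝ) ^ m / m.factorial * coeff (sqfreeExp Finset.univ) f := by
  have h := hf.mul_prod_gurvitsFactor_le_coeff (κ := m + 1) (by omega) hd hc hcap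
    fun i => ((degreeOf_le_totalDegree f i).trans hd.totalDegree_le).trans m.le_succ
  have hmin : ∀ i ∈ Finset.range m, gurvitsFactor (min (i + 1) (m + 1)) = gurvitsFactor (i + 1) :=
    fun i hi => by rw [min_eq_left (Nat.succ_le_succ (Finset.mem_range.1 hi).le)]
  rw [Finset.prod_congr rfl hmin, prod_gurvitsFactor] at h
  have hm : (0 : ℝ) < (m : ℝ) ^ m := by exact_mod_cast Nat.pow_self_pos
  calc c = (m : ℝ) ^ m / m.factorial * (c * (m.factorial / (m : ℝ) ^ m)) := by field_simp
    _ ≤ _ := by gcongr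

theorem le_two_pow_mul_coeff (hf : HurwitzStable f) (hd : f.IsHomogeneous m) (hc : 0 < c)
    (hcap : CapacityGE f 1 c) (hdeg : ∀ i, degreeOf i f ≤ 2) :
    c ≤ 2 ^ m * coeff (sqfreeExp Finset.univ) f := by
  calc c = 2 ^ m * (c * (1 / 2) ^ m) := by
        rw [one_div, inv_pow]
        field_simp
    _ ≤ 2 ^ m * (c * ∏ i ∈ Finset.range m, gurvitsFactor (min (i + 1) 2)) := by
        gcongr
        exact one_half_pow_le_prod_gurvitsFactor m
    _ ≤ _ := by
        gcongr
        exact hf.mul_prod_gurvitsFactor_le_coeff one_le_two hd hc hcap hdeg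

end HurwitzStable

end Gurvits


section Capacity

variable {m n : ℕ} {B : Finset (Finset (Fin m))} {g : MvPolynomial (Fin m) ℝ} {K : ℝ}

lemma CapacityGE.mul {σ : Type*} [Fintype σ] {f g : MvPolynomial σ ℝ} {θ η : σ → ℝ} {c d : ℝ}
    (hf : CapacityGE f θ c) (hg : CapacityGE g η d) (hc : 0 ≤ c) (hd : 0 ≤ d) :
    CapacityGE (f * g) (θ + η) (c * d) := by
  intro z hz
  have hprod_nonneg : ∀ ξ : σ → ℝ, 0 ≤ ∏ i, z i ^ ξ i := fun ξ =>
    Finset.prod_nonneg fun i _ => Real.rpow_nonneg (hz i).le _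
  calc c * d * ∏ i, z i ^ (θ + η) i = (c * ∏ i, z i ^ θ i) * (d * ∏ i, z i ^ η i) := by
        simp only [Pi.add_apply, Real.rpow_add (hz _), Finset.prod_mul_distrib]
        ring
    _ ≤ eval z f * eval z g :=
        mul_le_mul (hf z hz) (hg z hz) (mul_nonneg hd (hprod_nonneg η))
          ((mul_nonneg hc (hprod_nonneg θ)).trans (hf z hz))
    _ = eval z (f * g) := (map_mul _ _ _).symm

lemma NonnegCoeffs.eval_nonneg (hg : NonnegCoeffs g) {z : Fin m → ℝ} (hz : ∀ i, 0 ≤ z i) :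
    0 ≤ eval z g := by
  rw [eval_eq']
  exact Finset.sum_nonneg fun α _ =>
    mul_nonneg (hg α) (Finset.prod_nonneg fun i _ => pow_nonneg (hz i) _)

lemma capacity_le (hg : NonnegCoeffs g) (hK : 0 ≤ K)
    (h : ∀ θ ∈ basePolytope B, ∀ c > 0, CapacityGE g θ c → c ≤ K) : capacity B g ≤ K := by
  refine Real.iSup_le (fun θ => ?_) hK
  set c := ⨅ z : {z : Fin m → ℝ // ∀ i, 0 < z i}, eval z.1 g / ∏ i, (z.1 i) ^ (θ.1 i)
  rcases le_or_gt c 0 with hc0 | hc0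
  · exact hc0.trans hK
  refine h θ.1 θ.2 c hc0 fun z hz => ?_
  rw [← le_div_iff₀ (Finset.prod_pos fun i _ => Real.rpow_pos_of_pos (hz i) _)]
  refine ciInf_le ⟨0, ?_⟩ (⟨z, hz⟩ : {z : Fin m → ℝ // ∀ i, 0 < z i})
  rintro _ ⟨w, rfl⟩
  exact div_nonneg (hg.eval_nonneg fun i => (w.2 i).le)
    (Finset.prod_nonneg fun i _ => Real.rpow_nonneg (w.2 i).le _)

lemma approxRatio_le (hK : 0 ≤ K)
    (h : ∀ g : MvPolynomial (Fin m) ℝ, NonnegCoeffs g → HurwitzStable g → g.IsHomogeneous n →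
      ∀ θ ∈ basePolytope B, ∀ c > 0, CapacityGE g θ c → c ≤ K * famCoeff B g) :
    approxRatio n B ≤ K := by
  refine sSup_le ?_
  rintro _ ⟨g, hg, hstable, hhom, hpos, rfl⟩
  rw [EReal.coe_le_coe_iff, div_le_iff₀ hpos]
  exact capacity_le hg (mul_nonneg hK hpos.le) (h g hg (hstable.hurwitzStable hhom) hhom)

lemma approxRatioLin_le (hK : 0 ≤ K)
    (h : ∀ g : MvPolynomial (Fin m) ℝ, NonnegCoeffs g → Multiaffine g → HurwitzStable g →
      g.IsHomogeneous n → ∀ θ ∈ basePolytope B, ∀ c > 0, CapacityGE g θ c →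
      c ≤ K * famCoeff B g) :
    approxRatioLin n B ≤ K := by
  refine sSup_le ?_
  rintro _ ⟨g, hg, hlin, hstable, hhom, hpos, rfl⟩
  rw [EReal.coe_le_coe_iff, div_le_iff₀ hpos]
  exact capacity_le hg (mul_nonneg hK hpos.le) (h g hg hlin (hstable.hurwitzStable hhom) hhom)

end Capacity

section SquareFree

variable {m : ℕ}

lemma sqfreeExp_injective : Function.Injective (sqfreeExp : Finset (Fin m) → Fin m →₀ ℕ) := by
  intro S T h
  ext i
  have hi := DFunLike.congr_fun h i
  rw [sqfreeExp_apply, sqfreeExp_apply] at hi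
  split_ifs at hi with hS hT hT <;> simp_all

lemma eq_sqfreeExp {α : Fin m →₀ ℕ} (h : ∀ i, α i ≤ 1) :
    α = sqfreeExp (Finset.univ.filter fun i => α i = 1) := by
  ext i
  rw [sqfreeExp_apply]
  have hi := h i
  split_ifs with hα <;> simp at hα <;> omega

lemma degree_sqfreeExp (S : Finset (Fin m)) : (sqfreeExp S).degree = S.card := by
  simp [sqfreeExp]

lemma coeff_sqfreeExp_univ_mul (g h : MvPolynomial (Fin m) ℝ) :
    coeff (sqfreeExp Finset.univ) (g * h) =
      ∑ S : Finset (Fin m), coeff (sqfreeExp S) g * coeff (sqfreeExp Sᶜ) h := by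
  rw [coeff_mul]
  refine (Finset.sum_bij (fun S _ => (sqfreeExp S, sqfreeExp Sᶜ)) (fun S _ => ?_)
    (fun S _ T _ hST => sqfreeExp_injective (Prod.mk.inj hST).1) ?_ fun S _ => rfl).symm
  · rw [Finset.HasAntidiagonal.mem_antidiagonal]
    ext i
    by_cases hi : i ∈ S <;> simp [sqfreeExp_apply, hi]
  · rintro ⟨α, β⟩ hαβ
    rw [Finset.HasAntidiagonal.mem_antidiagonal] at hαβ
    have hadd : ∀ i, α i + β i = 1 := fun i => by
      simpa [sqfreeExp_apply] using DFunLike.congr_fun hαβ i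
    have hα := eq_sqfreeExp (α := α) fun i => (Nat.le_add_right _ _).trans (hadd i).le
    have hβ := eq_sqfreeExp (α := β) fun i => (Nat.le_add_left _ _).trans (hadd i).le
    have hcompl : (Finset.univ.filter fun i => α i = 1)ᶜ = Finset.univ.filter fun i => β i = 1 := by
      ext i
      have hi := hadd i
      simp only [Finset.mem_compl, Finset.mem_filter, Finset.mem_univ, true_and]
      omega
    exact ⟨Finset.univ.filter fun i => α i = 1, Finset.mem_univ _,
      Prod.ext hα.symm ((congrArg sqfreeExp hcompl).trans hβ.symm)⟩

lemma prod_pow_sqfreeExp {R : Type*} [CommSemiring R] (S : Finset (Fin m)) (z : Fin m → R) :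
    ∏ i, z i ^ sqfreeExp S i = ∏ i ∈ S, z i := by
  simp_rw [sqfreeExp_apply, pow_ite, pow_one, pow_zero]
  rw [Finset.prod_ite_mem, Finset.univ_inter]

lemma Multiaffine.degreeOf_le_one {g : MvPolynomial (Fin m) ℝ} (hg : Multiaffine g) (i : Fin m) :
    degreeOf i g ≤ 1 :=
  degreeOf_le_iff.2 fun α hα => hg α hα i

lemma coeff_sqfreeExp_genPoly (μ : Finset (Fin m) → ℝ) (S : Finset (Fin m)) :
    coeff (sqfreeExp S) (genPoly μ) = μ S := by
  simp [genPoly, coeff_sum, coeff_monomial, sqfreeExp_injective.eq_iff]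

lemma aeval_genPoly {A : Type*} [CommSemiring A] [Algebra ℝ A] (μ : Finset (Fin m) → ℝ)
    (z : Fin m → A) :
    aeval z (genPoly μ) = ∑ S, algebraMap ℝ A (μ S) * ∏ i ∈ S, z i := by
  rw [genPoly, map_sum]
  refine Finset.sum_congr rfl fun S _ => ?_
  rw [aeval_monomial, Finsupp.prod_fintype _ _ (by simp), prod_pow_sqfreeExp]

lemma isHomogeneous_genPoly {d : ℕ} {μ : Finset (Fin m) → ℝ} (hμ : ∀ S, μ S ≠ 0 → S.card = d) :
    (genPoly μ).IsHomogeneous d := by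
  refine IsHomogeneous.sum _ _ _ fun S _ => ?_
  by_cases hS : μ S = 0
  · rw [hS, monomial_zero]
    exact isHomogeneous_zero _ _ _
  · exact isHomogeneous_monomial _ (by rw [degree_sqfreeExp, hμ S hS])

lemma multiaffine_genPoly (μ : Finset (Fin m) → ℝ) : Multiaffine (genPoly μ) := by
  classical
  intro α hα i
  obtain ⟨S, -, hS⟩ := Finset.mem_biUnion.1 (support_sum hα)
  rw [Finset.mem_singleton.1 (support_monomial_subset hS), sqfreeExp_apply]
  split_ifs <;> simp

lemma Multiaffine.eq_genPoly {g : MvPolynomial (Fin m) ℝ} (hg : Multiaffine g) :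
    g = genPoly fun S => coeff (sqfreeExp S) g := by
  ext α
  by_cases hα : ∀ i, α i ≤ 1
  · rw [eq_sqfreeExp hα, coeff_sqfreeExp_genPoly]
  · rw [notMem_support_iff.1 fun h => hα (hg α h),
      notMem_support_iff.1 fun h => hα (multiaffine_genPoly _ α h)]

end SquareFree

section Selector

variable {m n k : ℕ} {B : Finset (Finset (Fin m))} {g h : MvPolynomial (Fin m) ℝ} {a b c : ℝ}

/-- The stable polynomial `h` selects the family `B`: among the square-free monomials, only those
of complements of members of `B` occur in `h`, with coefficients at most `a`, while for `θ ∈ P(B)`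
the capacity of `h` at the complementary exponent `1 - θ` is at least `b`. Multiplication by `h`
turns the sum of the coefficients of `g` over `B` into a single coefficient. -/
structure IsSelector (B : Finset (Finset (Fin m))) (h : MvPolynomial (Fin m) ℝ) (k : ℕ)
    (a b : ℝ) : Prop where
  hurwitzStable : HurwitzStable h
  isHomogeneous : h.IsHomogeneous k
  coeff_le : ∀ S ∈ B, coeff (sqfreeExp Sᶜ) h ≤ a
  coeff_eq_zero : ∀ S ∉ B, coeff (sqfreeExp Sᶜ) h = 0
  capacityGE : ∀ θ ∈ basePolytope B, CapacityGE h (1 - θ) b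

namespace IsSelector

lemma coeff_mul_le (hh : IsSelector B h k a b) (hg : NonnegCoeffs g) :
    coeff (sqfreeExp Finset.univ) (g * h) ≤ a * famCoeff B g := by
  rw [coeff_sqfreeExp_univ_mul, famCoeff, Finset.mul_sum,
    ← Finset.sum_subset (Finset.subset_univ B) fun S _ hS => by
      rw [hh.coeff_eq_zero S hS, mul_zero]]
  refine Finset.sum_le_sum fun S hS => ?_
  rw [mul_comm a]
  exact mul_le_mul_of_nonneg_left (hh.coeff_le S hS) (hg _)

lemma capacityGE_mul (hh : IsSelector B h k a b) (hb : 0 ≤ b) {θ : Fin m → ℝ}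
    (hθ : θ ∈ basePolytope B) (hc : 0 ≤ c) (hcap : CapacityGE g θ c) :
    CapacityGE (g * h) 1 (c * b) := by
  simpa using hcap.mul (hh.capacityGE θ hθ) hc hb

lemma le_mul_famCoeff (hh : IsSelector B h k a b) (hb : 0 < b) (hg : NonnegCoeffs g) {K : ℝ}
    (hK : 0 ≤ K) (hle : c * b ≤ K * coeff (sqfreeExp Finset.univ) (g * h)) :
    c ≤ a / b * K * famCoeff B g := by
  have hcb := hle.trans (mul_le_mul_of_nonneg_left (hh.coeff_mul_le hg) hK)
  calc c ≤ K * (a * famCoeff B g) / b := (le_div_iff₀ hb).2 hcb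
    _ = a / b * K * famCoeff B g := by ring

theorem approxRatio_le (hh : IsSelector B h k a b) (hk : n + k = m) (ha : 0 ≤ a) (hb : 0 < b) :
    approxRatio n B ≤ (a / b * ((m : ℝ) ^ m / m.factorial) : ℝ) := by
  subst hk
  refine BCapacity.approxRatio_le (by positivity) fun g hg hstable hhom θ hθ c hc hcap => ?_
  exact hh.le_mul_famCoeff hb hg (by positivity)
    ((hstable.mul hh.hurwitzStable).le_mul_coeff (hhom.mul hh.isHomogeneous) (mul_pos hc hb)
      (hh.capacityGE_mul hb.le hθ hc.le hcap))

theorem approxRatioLin_le (hh : IsSelector B h k a b) (hlin : Multiaffine h) (hk : n + k = m)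
    (ha : 0 ≤ a) (hb : 0 < b) : approxRatioLin n B ≤ (a / b * 2 ^ m : ℝ) := by
  subst hk
  refine BCapacity.approxRatioLin_le (by positivity)
    fun g hg hglin hstable hhom θ hθ c hc hcap => ?_
  exact hh.le_mul_famCoeff hb hg (by positivity)
    ((hstable.mul hh.hurwitzStable).le_two_pow_mul_coeff (hhom.mul hh.isHomogeneous)
      (mul_pos hc hb) (hh.capacityGE_mul hb.le hθ hc.le hcap) fun i =>
        (degreeOf_mul_le i g h).trans (add_le_add (hglin.degreeOf_le_one i)
          (hlin.degreeOf_le_one i)))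

end IsSelector

end Selector

section Weight

variable {m k : ℕ} {B : Finset (Finset (Fin m))} {μ : Finset (Fin m) → ℝ} {P : ℝ}

lemma prod_rpow_one_sub_charVec (z : Fin m → ℝ) (S : Finset (Fin m)) :
    ∏ i, z i ^ ((1 : Fin m → ℝ) - charVec S) i = ∏ i ∈ Sᶜ, z i := by
  rw [← Finset.univ_inter Sᶜ, ← Finset.prod_ite_mem]
  refine Finset.prod_congr rfl fun i _ => ?_
  by_cases hi : i ∈ S <;> simp [charVec, hi]

lemma convexOn_prod_rpow_one_sub {z : Fin m → ℝ} (hz : ∀ i, 0 < z i) :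
    ConvexOn ℝ Set.univ fun θ : Fin m → ℝ => ∏ i, z i ^ (1 - θ) i := by
  let ℓ : (Fin m → ℝ) →ₗ[ℝ] ℝ := ∑ i, -Real.log (z i) • LinearMap.proj i
  have hexp : (fun θ : Fin m → ℝ => ∏ i, z i ^ (1 - θ) i) = fun θ =>
      (∏ i, z i) • (Real.exp ∘ ℓ) θ := by
    funext θ
    simp only [ℓ, Function.comp_apply, LinearMap.sum_apply, LinearMap.smul_apply,
      LinearMap.proj_apply, Real.exp_sum, smul_eq_mul, ← Finset.prod_mul_distrib]
    refine Finset.prod_congr rfl fun i _ => ?_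
    rw [Pi.sub_apply, Pi.one_apply, sub_eq_add_neg, Real.rpow_add (hz i), Real.rpow_one,
      Real.rpow_def_of_pos (hz i) (-θ i), neg_mul, mul_neg]
  rw [hexp]
  exact (convexOn_exp.comp_linearMap ℓ).smul (Finset.prod_nonneg fun i _ => (hz i).le)

lemma prod_rpow_one_sub_le_sum {θ : Fin m → ℝ} (hθ : θ ∈ basePolytope B) {z : Fin m → ℝ}
    (hz : ∀ i, 0 < z i) : ∏ i, z i ^ (1 - θ) i ≤ ∑ S ∈ B, ∏ i ∈ Sᶜ, z i := by
  suffices h : basePolytope B ⊆ {η ∈ Set.univ | ∏ i, z i ^ (1 - η) i ≤ ∑ S ∈ B, ∏ i ∈ Sᶜ, z i} from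
    (h hθ).2
  refine convexHull_min ?_ ((convexOn_prod_rpow_one_sub hz).convex_le _)
  rintro _ ⟨S, hS, rfl⟩
  refine ⟨Set.mem_univ _, ?_⟩
  rw [prod_rpow_one_sub_charVec]
  exact Finset.single_le_sum (f := fun S => ∏ i ∈ Sᶜ, z i)
    (fun T _ => Finset.prod_nonneg fun i _ => (hz i).le) hS

lemma capacityGE_genPoly {b : ℝ} (hb : 0 ≤ b) (hge : ∀ S ∈ B, b ≤ μ Sᶜ)
    (hzero : ∀ S ∉ B, μ Sᶜ = 0) {θ : Fin m → ℝ} (hθ : θ ∈ basePolytope B) :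
    CapacityGE (genPoly μ) (1 - θ) b := by
  intro z hz
  have hprod_nonneg : ∀ S : Finset (Fin m), 0 ≤ ∏ i ∈ S, z i := fun S =>
    Finset.prod_nonneg fun i _ => (hz i).le
  calc b * ∏ i, z i ^ (1 - θ) i ≤ b * ∑ S ∈ B, ∏ i ∈ Sᶜ, z i :=
        mul_le_mul_of_nonneg_left (prod_rpow_one_sub_le_sum hθ hz) hb
    _ ≤ ∑ S ∈ B, μ Sᶜ * ∏ i ∈ Sᶜ, z i := by
        rw [Finset.mul_sum]
        exact Finset.sum_le_sum fun S hS => mul_le_mul_of_nonneg_right (hge S hS) (hprod_nonneg _)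
    _ = ∑ S, μ Sᶜ * ∏ i ∈ Sᶜ, z i :=
        Finset.sum_subset (Finset.subset_univ _) fun S _ hS => by rw [hzero S hS, zero_mul]
    _ = ∑ S, μ S * ∏ i ∈ S, z i :=
        Equiv.sum_comp (compl_involutive.toPerm compl) fun S => μ S * ∏ i ∈ S, z i
    _ = eval z (genPoly μ) := by simpa [aeval_eq_eval] using (aeval_genPoly μ z).symm

lemma exists_isSelector_genPoly (hB : B.Nonempty) (hcard : ∀ S ∈ B, Sᶜ.card = k)
    (hpos : ∀ S ∈ B, 0 < μ Sᶜ) (hzero : ∀ S ∉ B, μ Sᶜ = 0) (hstable : HurwitzStable (genPoly μ))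
    (hP : ∀ S ∈ B, ∀ T ∈ B, μ Sᶜ / μ Tᶜ ≤ P) :
    ∃ b > 0, IsSelector B (genPoly μ) k (P * b) b := by
  obtain ⟨T, hT, hmin⟩ := Finset.exists_min_image B (fun S => μ Sᶜ) hB
  refine ⟨μ Tᶜ, hpos T hT, hstable, isHomogeneous_genPoly fun S hS => ?_, fun S hS => ?_,
    fun S hS => ?_, fun θ hθ => capacityGE_genPoly (hpos T hT).le hmin hzero hθ⟩
  · by_contra hne
    refine hS ?_
    rw [← compl_compl S]
    refine hzero _ fun h => hne ?_
    rw [← compl_compl S]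
    exact hcard _ h
  · rw [coeff_sqfreeExp_genPoly, ← div_le_iff₀ (hpos T hT)]
    exact hP S hS T hT
  · rw [coeff_sqfreeExp_genPoly, hzero S hS]

end Weight

section MatroidWeight

variable {m n : ℕ} {M : Matroid (Fin m)} {μ : Finset (Fin m) → ℝ} {P : ℝ}

lemma mem_bases {S : Finset (Fin m)} : S ∈ bases M ↔ M.IsBase (S : Set (Fin m)) := by
  simp [bases]

lemma bases_nonempty (M : Matroid (Fin m)) : (bases M).Nonempty := by
  obtain ⟨B, hB⟩ := M.exists_isBase
  exact ⟨B.toFinite.toFinset, mem_bases.2 (by simpa using hB)⟩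

lemma compl_mem_bases_dual (hE : M.E = Set.univ) {S : Finset (Fin m)} :
    Sᶜ ∈ bases M.dual ↔ S ∈ bases M := by
  rw [mem_bases, mem_bases, M.dual_isBase_iff (by rw [hE]; exact Set.subset_univ _), hE,
    Finset.coe_compl, ← Set.compl_eq_univ_sdiff, compl_compl]

lemma exists_isSelector_of_weight (hE : M.E = Set.univ) (hn : ∀ S ∈ bases M, S.card = n)
    (hpos : ∀ S ∈ bases M.dual, 0 < μ S) (hzero : ∀ S ∉ bases M.dual, μ S = 0)
    (hstable : HurwitzStable (genPoly μ))
    (hP : ∀ S ∈ bases M.dual, ∀ T ∈ bases M.dual, μ S / μ T ≤ P) :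
    n + (m - n) = m ∧ 0 ≤ P ∧ ∃ b > 0, IsSelector (bases M) (genPoly μ) (m - n) (P * b) b := by
  have hmem : ∀ S, Sᶜ ∈ bases M.dual ↔ S ∈ bases M := fun S => compl_mem_bases_dual hE
  obtain ⟨S, hS⟩ := bases_nonempty M
  refine ⟨?_, ?_, exists_isSelector_genPoly (bases_nonempty M) (fun S hS => ?_)
    (fun S hS => hpos _ ((hmem S).2 hS)) (fun S hS => hzero _ (mt (hmem S).1 hS)) hstable
    fun S hS T hT => hP _ ((hmem S).2 hS) _ ((hmem T).2 hT)⟩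
  · rw [← hn S hS]
    exact Nat.add_sub_of_le (card_finset_fin_le S)
  · have hself := hP _ ((hmem S).2 hS) _ ((hmem S).2 hS)
    rw [div_self (hpos _ ((hmem S).2 hS)).ne'] at hself
    exact zero_le_one.trans hself
  · rw [Finset.card_compl, Fintype.card_fin, hn S hS]

theorem approxRatio_le_of_weight (hE : M.E = Set.univ) (hn : ∀ S ∈ bases M, S.card = n)
    (hpos : ∀ S ∈ bases M.dual, 0 < μ S) (hzero : ∀ S ∉ bases M.dual, μ S = 0)
    (hstable : HurwitzStable (genPoly μ))
    (hP : ∀ S ∈ bases M.dual, ∀ T ∈ bases M.dual, μ S / μ T ≤ P) :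
    approxRatio n (bases M) ≤ (P * ((m : ℝ) ^ m / m.factorial) : ℝ) ∧
      approxRatioLin n (bases M) ≤ (P * 2 ^ m : ℝ) := by
  obtain ⟨hk, hP0, b, hb, hsel⟩ := exists_isSelector_of_weight hE hn hpos hzero hstable hP
  have hPb : P * b / b = P := mul_div_cancel_right₀ _ hb.ne'
  constructor
  · simpa only [hPb] using hsel.approxRatio_le hk (mul_nonneg hP0 hb.le) hb
  · simpa only [hPb] using
      hsel.approxRatioLin_le (multiaffine_genPoly μ) hk (mul_nonneg hP0 hb.le) hb

end MatroidWeight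

section StronglyRayleigh

variable {m n : ℕ} {M : Matroid (Fin m)} {μ : Finset (Fin m) → ℝ} {P : ℝ}

theorem IsStronglyRayleighOn.approxRatio_le (hμ : IsStronglyRayleighOn (bases M.dual) μ)
    (hE : M.E = Set.univ) (hn : ∀ S ∈ bases M, S.card = n)
    (hP : ∀ S ∈ bases M.dual, ∀ T ∈ bases M.dual, μ S / μ T ≤ P) :
    approxRatio n (bases M) ≤ (P * ((m : ℝ) ^ m / m.factorial) : ℝ) ∧
      approxRatioLin n (bases M) ≤ (P * 2 ^ m : ℝ) := by
  have hcard : ∀ S, μ S ≠ 0 → S.card = m - n := fun S hS => by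
    have hSc : Sᶜ ∈ bases M := by
      rw [← compl_mem_bases_dual hE, compl_compl]
      exact not_imp_comm.1 (hμ.zero S) hS
    have hsum := Finset.card_add_card_compl S
    rw [hn _ hSc, Fintype.card_fin] at hsum
    omega
  exact approxRatio_le_of_weight hE hn hμ.pos hμ.zero
    (hμ.stable.hurwitzStable (isHomogeneous_genPoly hcard)) hP

end StronglyRayleigh

section CauchyBinet

open Matrix

variable {ι κ R : Type*} [CommRing R]

lemma det_submatrix_eq_zero_of_not_injective [Fintype κ] [DecidableEq κ]
    (V : Matrix ι κ R) {φ : κ → ι} (hφ : ¬ Function.Injective φ) : (V.submatrix φ id).det = 0 := by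
  obtain ⟨k, l, hkl, hne⟩ := Function.not_injective_iff.1 hφ
  exact det_zero_of_row_eq hne (by funext j; simp [hkl])

lemma transpose_mul_diagonal_indicator_mul [Fintype ι] [DecidableEq ι] (V : Matrix ι κ R)
    (S : Finset ι) :
    Vᵀ * diagonal (fun i => if i ∈ S then (1 : R) else 0) * V =
      (V.submatrix ((↑) : S → ι) id)ᵀ * V.submatrix ((↑) : S → ι) id := by
  ext k l
  rw [mul_apply, mul_apply]
  simp only [mul_diagonal, transpose_apply, submatrix_apply, id, mul_ite, mul_one,
    mul_zero, ite_mul, zero_mul, Finset.sum_ite_mem, Finset.univ_inter]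
  exact (Finset.sum_coe_sort S fun i => V i k * V i l).symm

variable [Fintype ι] [DecidableEq ι] [Fintype κ] [DecidableEq κ]

lemma det_transpose_mul_diagonal_mul (V : Matrix ι κ R) (z : ι → R) :
    (Vᵀ * diagonal z * V).det =
      ∑ φ : κ → ι, (∏ k, V (φ k) k) * (V.submatrix φ id).det * ∏ k, z (φ k) := by
  have hrows : Vᵀ * diagonal z * V = fun k => ∑ i, (V i k * z i) • V i := by
    funext k l
    rw [mul_apply]
    simp [mul_diagonal, Finset.sum_apply]
  rw [hrows]
  refine ((detRowAlternating (n := κ) (R := R)).toMultilinearMap.map_sum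
    (g := fun k i => (V i k * z i) • V i)).trans (Finset.sum_congr rfl fun φ _ => ?_)
  rw [MultilinearMap.map_smul_univ, smul_eq_mul, Finset.prod_mul_distrib, mul_right_comm]
  rfl

lemma exists_det_transpose_mul_diagonal_mul_eq_sum (V : Matrix ι κ R) :
    ∃ c : Finset ι → R, (∀ S, S.card ≠ Fintype.card κ → c S = 0) ∧
      ∀ z : ι → R, (Vᵀ * diagonal z * V).det = ∑ S, c S * ∏ i ∈ S, z i := by
  refine ⟨fun S => ∑ φ : κ → ι with Finset.univ.image φ = S,
    (∏ k, V (φ k) k) * (V.submatrix φ id).det, fun S hS => ?_, fun z => ?_⟩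
  · refine Finset.sum_eq_zero fun φ hφ => ?_
    rw [det_submatrix_eq_zero_of_not_injective V fun hinj => hS ?_, mul_zero]
    rw [← (Finset.mem_filter.1 hφ).2, Finset.card_image_of_injective _ hinj, Finset.card_univ]
  · have hterm (φ : κ → ι) : (∏ k, V (φ k) k) * (V.submatrix φ id).det * ∏ k, z (φ k) =
        (∏ k, V (φ k) k) * (V.submatrix φ id).det * ∏ i ∈ Finset.univ.image φ, z i := by
      by_cases hφ : Function.Injective φ
      · rw [Finset.prod_image hφ.injOn]
      · rw [det_submatrix_eq_zero_of_not_injective V hφ, mul_zero, zero_mul, zero_mul]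
    rw [det_transpose_mul_diagonal_mul, Finset.sum_congr rfl fun φ _ => hterm φ,
      ← Finset.sum_fiberwise (g := fun φ : κ → ι => Finset.univ.image φ)]
    refine Finset.sum_congr rfl fun S _ => ?_
    rw [Finset.sum_mul]
    exact Finset.sum_congr rfl fun φ hφ => by rw [(Finset.mem_filter.1 hφ).2]

theorem det_transpose_mul_diagonal_mul_eq_sum_det (V : Matrix ι κ R) (z : ι → R) :
    (Vᵀ * diagonal z * V).det = ∑ S with S.card = Fintype.card κ,
      ((V.submatrix ((↑) : S → ι) id)ᵀ * V.submatrix ((↑) : S → ι) id).det * ∏ i ∈ S, z i := by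
  obtain ⟨c, hc0, hc⟩ := exists_det_transpose_mul_diagonal_mul_eq_sum V
  -- The coefficient of `S` is isolated by evaluating at the indicator vector of `S`.
  have hcoeff (S : Finset ι) (hS : S.card = Fintype.card κ) :
      ((V.submatrix ((↑) : S → ι) id)ᵀ * V.submatrix ((↑) : S → ι) id).det = c S := by
    rw [← transpose_mul_diagonal_indicator_mul, hc,
      Finset.sum_eq_single_of_mem S (Finset.mem_univ S) fun T _ hTS => ?_,
      Finset.prod_congr rfl fun i hi => if_pos hi, Finset.prod_const_one, mul_one]
    by_cases hT : T.card = Fintype.card κ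
    · obtain ⟨i, hiT, hiS⟩ := Finset.not_subset.1 fun hsub =>
        hTS (Finset.eq_of_subset_of_card_le hsub (hS.trans hT.symm).le)
      rw [Finset.prod_eq_zero hiT (if_neg hiS), mul_zero]
    · rw [hc0 T hT, zero_mul]
  rw [hc, Finset.sum_filter]
  refine Finset.sum_congr rfl fun S _ => ?_
  split_ifs with hS
  · rw [hcoeff S hS]
  · rw [hc0 S hS, zero_mul]

end CauchyBinet

section HermitianForm

open Matrix

variable {ι κ : Type*} [Fintype ι] [DecidableEq ι] [Fintype κ]

lemma mulVec_eq_zero_of_conjTranspose_mul_diagonal_mul (W : Matrix ι κ ℂ) {z : ι → ℂ}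
    (hz : ∀ i, 0 < (z i).re) {v : κ → ℂ} (hv : (Wᴴ * diagonal z * W) *ᵥ v = 0) : W *ᵥ v = 0 := by
  have hform : star (W *ᵥ v) ⬝ᵥ (diagonal z *ᵥ (W *ᵥ v)) = 0 := by
    rw [star_mulVec, ← dotProduct_mulVec, mulVec_mulVec, mulVec_mulVec, hv,
      dotProduct_zero]
  have hterm (i : ι) : (star (W *ᵥ v) i * (z i * (W *ᵥ v) i)).re =
      (z i).re * Complex.normSq ((W *ᵥ v) i) := by
    rw [Pi.star_apply, mul_left_comm, Complex.star_def, mul_comm _ ((W *ᵥ v) i),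
      Complex.mul_conj, Complex.re_mul_ofReal]
  have hsum : ∑ i, (z i).re * Complex.normSq ((W *ᵥ v) i) = 0 := by
    simpa only [dotProduct, mulVec_diagonal, Complex.re_sum, hterm, Complex.zero_re] using
      congrArg Complex.re hform
  funext i
  have hi := (Finset.sum_eq_zero_iff_of_nonneg fun i _ =>
    mul_nonneg (hz i).le (Complex.normSq_nonneg _)).1 hsum i (Finset.mem_univ i)
  exact Complex.normSq_eq_zero.1 ((mul_eq_zero.1 hi).resolve_left (hz i).ne')

lemma det_conjTranspose_mul_self_eq_zero_of_diagonal [DecidableEq κ] (W : Matrix ι κ ℂ)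
    {z : ι → ℂ} (hz : ∀ i, 0 < (z i).re) (h : (Wᴴ * diagonal z * W).det = 0) :
    (Wᴴ * W).det = 0 := by
  obtain ⟨v, hv0, hv⟩ := exists_mulVec_eq_zero_iff.2 h
  refine exists_mulVec_eq_zero_iff.1 ⟨v, hv0, ?_⟩
  rw [← mulVec_mulVec, mulVec_eq_zero_of_conjTranspose_mul_diagonal_mul W hz hv, mulVec_zero]

end HermitianForm

section Representation

variable {m d : ℕ} {N : Matroid (Fin m)} {V : Matrix (Fin m) (Fin d) ℝ}

lemma rowDet_eq_sq (V : Matrix (Fin m) (Fin d) ℝ) {S : Finset (Fin m)} (e : Fin d ≃ S) :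
    rowDet V S = (V.submatrix (fun k => (e k : Fin m)) id).det ^ 2 := by
  have hsub : V.submatrix (fun k => (e k : Fin m)) id = (rowSubmatrix V S).submatrix e id := rfl
  rw [hsub, sq]
  nth_rewrite 1 [← Matrix.det_transpose]
  rw [← Matrix.det_mul, Matrix.transpose_submatrix, Matrix.submatrix_mul_equiv,
    Matrix.submatrix_id_id, rowDet]

lemma card_eq_of_mem_bases (hr : N.eRank = d) {S : Finset (Fin m)} (hS : S ∈ bases N) :
    S.card = d := by
  have hcard := (mem_bases.1 hS).encard_eq_eRank
  rw [hr, Set.encard_coe_eq_coe_finsetCard] at hcard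
  exact_mod_cast hcard

lemma mem_bases_iff_indep (hr : N.eRank = d) {S : Finset (Fin m)} (hS : S.card = d) :
    S ∈ bases N ↔ N.Indep S := by
  refine ⟨fun h => (mem_bases.1 h).indep, fun h => mem_bases.2 (h.isBase_of_eRk_ge ?_ ?_)⟩
  · exact S.finite_toSet
  · rw [hr, h.eRk_eq_encard, Set.encard_coe_eq_coe_finsetCard, hS]

lemma IsRepresentation.indep_iff_linearIndepOn (hV : IsRepresentation N V) (S : Set (Fin m)) :
    N.Indep S ↔ LinearIndepOn ℝ V.row S := by
  obtain ⟨S, rfl⟩ := S.toFinite.exists_finset_coe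
  exact hV S

lemma IsRepresentation.rowDet_ne_zero_iff (hV : IsRepresentation N V) {S : Finset (Fin m)}
    (hS : S.card = d) : rowDet V S ≠ 0 ↔ N.Indep S := by
  have e : Fin d ≃ S := (S.equivFinOfCardEq hS).symm
  rw [rowDet_eq_sq V e, pow_ne_zero_iff two_ne_zero, ← isUnit_iff_ne_zero,
    ← Matrix.isUnit_iff_isUnit_det, ← Matrix.linearIndependent_rows_iff_isUnit, hV S,
    ← linearIndependent_equiv e]
  rfl

/-- The weight `det (V_Sᵀ V_S)` of the bases `S` of the matroid represented by `V`, extended by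
zero to the other sets. -/
def baseWeight (N : Matroid (Fin m)) (V : Matrix (Fin m) (Fin d) ℝ) (S : Finset (Fin m)) : ℝ :=
  if S ∈ bases N then rowDet V S else 0

lemma IsRepresentation.rowDet_pos (hV : IsRepresentation N V) (hr : N.eRank = d)
    {S : Finset (Fin m)} (hS : S ∈ bases N) : 0 < rowDet V S := by
  have hcard := card_eq_of_mem_bases hr hS
  refine lt_of_le_of_ne ?_ ((hV.rowDet_ne_zero_iff hcard).2 (mem_bases.1 hS).indep).symm
  rw [rowDet_eq_sq V (S.equivFinOfCardEq hcard).symm]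
  exact sq_nonneg _

lemma IsRepresentation.baseWeight_pos (hV : IsRepresentation N V) (hr : N.eRank = d)
    {S : Finset (Fin m)} (hS : S ∈ bases N) : 0 < baseWeight N V S := by
  rw [baseWeight, if_pos hS]
  exact hV.rowDet_pos hr hS

lemma baseWeight_of_notMem {S : Finset (Fin m)} (hS : S ∉ bases N) : baseWeight N V S = 0 :=
  if_neg hS

lemma IsRepresentation.baseWeight_eq (hV : IsRepresentation N V) (hr : N.eRank = d)
    (S : Finset (Fin m)) : baseWeight N V S = if S.card = d then rowDet V S else 0 := by
  rw [baseWeight]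
  by_cases hcard : S.card = d
  · rw [if_pos hcard, ite_eq_left_iff, mem_bases_iff_indep hr hcard,
      ← hV.rowDet_ne_zero_iff hcard, not_not]
    exact Eq.symm
  · rw [if_neg hcard, if_neg fun hS => hcard (card_eq_of_mem_bases hr hS)]

lemma IsRepresentation.aeval_genPoly_baseWeight (hV : IsRepresentation N V) (hr : N.eRank = d)
    (z : Fin m → ℂ) :
    aeval z (genPoly (baseWeight N V)) =
      ((V.map Complex.ofReal).conjTranspose * Matrix.diagonal z * V.map Complex.ofReal).det := by
  have hconj : (V.map Complex.ofReal).conjTranspose = (V.map Complex.ofReal).transpose := by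
    ext k i
    simp
  have hdet (S : Finset (Fin m)) : (rowDet V S : ℂ) =
      (((V.map Complex.ofReal).submatrix ((↑) : S → Fin m) id).transpose *
        (V.map Complex.ofReal).submatrix ((↑) : S → Fin m) id).det := by
    rw [rowDet, ← Complex.ofRealHom_eq_coe, RingHom.map_det, RingHom.mapMatrix_apply,
      Matrix.map_mul]
    rfl
  rw [hconj, det_transpose_mul_diagonal_mul_eq_sum_det, aeval_genPoly, Finset.sum_filter]
  refine Finset.sum_congr rfl fun S _ => ?_
  rw [hV.baseWeight_eq hr, Fintype.card_fin]
  split_ifs with hS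
  · rw [← hdet]; rfl
  · simp

theorem IsRepresentation.hurwitzStable_baseWeight (hV : IsRepresentation N V)
    (hr : N.eRank = d) : HurwitzStable (genPoly (baseWeight N V)) := by
  intro z hz h0
  have hone : aeval (1 : Fin m → ℂ) (genPoly (baseWeight N V)) = 0 := by
    rw [hV.aeval_genPoly_baseWeight hr] at h0 ⊢
    rw [show Matrix.diagonal (1 : Fin m → ℂ) = 1 from Matrix.diagonal_one, Matrix.mul_one]
    exact det_conjTranspose_mul_self_eq_zero_of_diagonal _ hz h0
  have hsum : ∑ S, baseWeight N V S = 0 := by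
    simpa [aeval_genPoly, ← Complex.ofReal_sum] using hone
  obtain ⟨S, hS⟩ := bases_nonempty N
  refine hsum.not_gt
    (Finset.sum_pos' (fun T _ => ?_) ⟨S, Finset.mem_univ S, hV.baseWeight_pos hr hS⟩)
  by_cases hT : T ∈ bases N
  · exact (hV.baseWeight_pos hr hT).le
  · exact (baseWeight_of_notMem hT).ge

lemma div_le_matrixUnbalance (V : Matrix (Fin m) (Fin d) ℝ) {B : Finset (Finset (Fin m))}
    {S T : Finset (Fin m)} (hS : S ∈ B) (hT : T ∈ B) :
    rowDet V S / rowDet V T ≤ matrixUnbalance B V := by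
  have hfin : {r : ℝ | ∃ S ∈ B, ∃ T ∈ B, r = rowDet V S / rowDet V T}.Finite := by
    refine ((B ×ˢ B).finite_toSet.image fun p => rowDet V p.1 / rowDet V p.2).subset ?_
    rintro _ ⟨S, hS, T, hT, rfl⟩
    exact ⟨(S, T), Finset.mem_product.2 ⟨hS, hT⟩, rfl⟩
  exact le_csSup hfin.bddAbove ⟨S, hS, T, hT, rfl⟩

theorem IsRepresentation.approxRatio_le {n : ℕ} {M : Matroid (Fin m)} (hE : M.E = Set.univ)
    (hn : ∀ S ∈ bases M, S.card = n) (hV : IsRepresentation M.dual V) (hr : M.dual.eRank = d) :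
    approxRatio n (bases M) ≤
        (matrixUnbalance (bases M.dual) V * ((m : ℝ) ^ m / m.factorial) : ℝ) ∧
      approxRatioLin n (bases M) ≤ (matrixUnbalance (bases M.dual) V * 2 ^ m : ℝ) := by
  refine approxRatio_le_of_weight hE hn (fun S => hV.baseWeight_pos hr)
    (fun S => baseWeight_of_notMem) (hV.hurwitzStable_baseWeight hr) fun S hS T hT => ?_
  rw [baseWeight, baseWeight, if_pos hS, if_pos hT]
  exact div_le_matrixUnbalance V hS hT

end Representation

section DualRepresentation

lemma map_eq_sum_smul_map_single {ι R E : Type*} [Fintype ι] [DecidableEq ι] [Semiring R]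
    [AddCommMonoid E] [Module R E] (f : (ι → R) →ₗ[R] E) (y : ι → R) :
    f y = ∑ i, y i • f (Pi.single i 1) := by
  conv_lhs => rw [← (Pi.basisFun R ι).sum_repr y]
  simp

lemma mem_span_iff_forall_dotProduct {κ K : Type*} [Fintype κ] [Field K]
    {s : Set (κ → K)} {w : κ → K} :
    w ∈ Submodule.span K s ↔ ∀ x : κ → K, (∀ u ∈ s, u ⬝ᵥ x = 0) → w ⬝ᵥ x = 0 := by
  constructor
  · intro hw x hx
    induction hw using Submodule.span_induction with
    | mem u hu => exact hx u hu
    | zero => exact zero_dotProduct x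
    | add u v _ _ hu hv => rw [add_dotProduct, hu, hv, add_zero]
    | smul a u _ hu => rw [smul_dotProduct, hu, smul_zero]
  · classical
    intro h
    by_contra hw
    obtain ⟨f, hfw, hf⟩ := Submodule.exists_le_ker_of_notMem hw
    have hdot (u : κ → K) : f u = u ⬝ᵥ fun k => f (Pi.single k 1) := by
      simpa [dotProduct] using map_eq_sum_smul_map_single f u
    refine hfw ?_
    rw [hdot]
    exact h _ fun u hu => (hdot u).symm.trans (hf (Submodule.subset_span hu))

lemma linearIndepOn_map_single_iff {ι R E : Type*} [Finite ι] [DecidableEq ι] [Ring R]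
    [AddCommGroup E] [Module R E] (π : (ι → R) →ₗ[R] E) (S : Finset ι) :
    LinearIndepOn R (fun i => π (Pi.single i 1)) S ↔
      ∀ y ∈ LinearMap.ker π, (∀ i ∉ S, y i = 0) → y = 0 := by
  cases nonempty_fintype ι
  have hπ (y : ι → R) (hy : ∀ i ∉ S, y i = 0) : π y = ∑ i ∈ S, y i • π (Pi.single i 1) := by
    rw [Finset.sum_subset S.subset_univ fun i _ hi => by rw [hy i hi, zero_smul]]
    exact map_eq_sum_smul_map_single π y
  rw [linearIndepOn_finset_iff]
  constructor
  · intro h y hker hy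
    funext i
    by_cases hi : i ∈ S
    · exact h y (by rw [← hπ y hy, LinearMap.mem_ker.1 hker]) i hi
    · exact hy i hi
  · intro h f hf i hi
    have hy (j : ι) (hj : j ∉ S) : S.piecewise f 0 j = 0 := S.piecewise_eq_of_notMem f 0 hj
    have hzero := h (S.piecewise f 0) ?_ hy
    · rw [← S.piecewise_eq_of_mem f 0 hi, hzero, Pi.zero_apply]
    · rw [LinearMap.mem_ker, hπ _ hy, ← hf]
      exact Finset.sum_congr rfl fun j hj => by rw [S.piecewise_eq_of_mem f 0 hj]

variable {m d : ℕ} {N : Matroid (Fin m)} {V : Matrix (Fin m) (Fin d) ℝ}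

lemma IsRepresentation.mem_closure_iff_of_indep (hV : IsRepresentation N V)
    (hE : N.E = Set.univ) {I : Set (Fin m)} (hI : N.Indep I) (i : Fin m) :
    i ∈ N.closure I ↔ V.row i ∈ Submodule.span ℝ (V.row '' I) := by
  rw [hI.mem_closure_iff', hE]
  by_cases hi : i ∈ I
  · exact iff_of_true ⟨Set.mem_univ i, fun _ => hi⟩
      (Submodule.subset_span (Set.mem_image_of_mem V.row hi))
  · have hins : N.Indep (insert i I) ↔ V.row i ∉ Submodule.span ℝ (V.row '' I) := by
      rw [hV.indep_iff_linearIndepOn, linearIndepOn_insert hi,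
        and_iff_right ((hV.indep_iff_linearIndepOn I).1 hI)]
    simp [hi, hins]

lemma IsRepresentation.mem_closure_iff (hV : IsRepresentation N V) (hE : N.E = Set.univ)
    (X : Set (Fin m)) (i : Fin m) : i ∈ N.closure X ↔ V.row i ∈ Submodule.span ℝ (V.row '' X) := by
  obtain ⟨I, hI⟩ := N.exists_isBasis X (hE ▸ X.subset_univ)
  have hspan : Submodule.span ℝ (V.row '' X) = Submodule.span ℝ (V.row '' I) := by
    refine le_antisymm (Submodule.span_le.2 ?_) (Submodule.span_mono (Set.image_mono hI.subset))
    rintro _ ⟨j, hj, rfl⟩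
    exact (hV.mem_closure_iff_of_indep hE hI.indep j).1 (hI.subset_closure hj)
  rw [← hI.closure_eq_closure, hV.mem_closure_iff_of_indep hE hI.indep, hspan]

lemma IsRepresentation.dual_indep_iff (hV : IsRepresentation N V) (hE : N.E = Set.univ)
    (S : Finset (Fin m)) :
    N.dual.Indep S ↔ ∀ y ∈ LinearMap.range V.mulVecLin, (∀ i ∉ S, y i = 0) → y = 0 := by
  rw [← Matroid.coindep_def, N.coindep_iff_compl_spanning (hE ▸ Set.subset_univ _),
    Matroid.spanning_iff_ground_subset_closure, hE]
  simp only [Set.univ_subset_iff, Set.eq_univ_iff_forall, hV.mem_closure_iff hE,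
    mem_span_iff_forall_dotProduct, Set.forall_mem_image, Set.mem_sdiff, Set.mem_univ, true_and]
  rw [forall_comm]
  simp only [LinearMap.mem_range, forall_exists_index, forall_apply_eq_imp_iff]
  exact forall_congr' fun x =>
    ⟨fun h hx => funext fun i => h i hx, fun h i hx => congrFun (h hx) i⟩

lemma IsRepresentation.eRank_eq (hV : IsRepresentation N V) (hE : N.E = Set.univ)
    (hspan : Submodule.span ℝ (Set.range V.row) = ⊤) : N.eRank = d := by
  obtain ⟨S, hS⟩ := bases_nonempty N
  have hB := mem_bases.1 hS
  have htop : Submodule.span ℝ (V.row '' S) = ⊤ := by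
    refine eq_top_iff.2 (hspan.ge.trans (Submodule.span_le.2 ?_))
    rintro _ ⟨i, rfl⟩
    exact (hV.mem_closure_iff hE S i).1 (hB.closure_eq ▸ hE ▸ Set.mem_univ i)
  have hcard := finrank_span_eq_card ((hV S).1 hB.indep)
  have himage : Set.range (fun i : S => V i) = V.row '' S := Set.image_eq_range V.row S |>.symm
  rw [himage, htop, finrank_top, Module.finrank_fin_fun, Fintype.card_coe] at hcard
  rw [← hB.encard_eq_eRank, Set.encard_coe_eq_coe_finsetCard, hcard]

theorem IsRepresentation.exists_dual (hV : IsRepresentation N V) (hE : N.E = Set.univ) :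
    ∃ (k : ℕ) (W : Matrix (Fin m) (Fin k) ℝ), N.dual.eRank = k ∧ IsRepresentation N.dual W := by
  -- The rows of `W` are the images of the unit vectors in the quotient by the column space of `V`.
  let L := LinearMap.range V.mulVecLin
  let b := Module.finBasis ℝ ((Fin m → ℝ) ⧸ L)
  let π := b.equivFun.toLinearMap ∘ₗ L.mkQ
  have hker : LinearMap.ker π = L := by
    rw [LinearMap.ker_comp, LinearEquiv.ker, Submodule.comap_bot, Submodule.ker_mkQ]
  have hsurj : LinearMap.range π = ⊤ :=
    LinearMap.range_eq_top.2 (b.equivFun.surjective.comp L.mkQ_surjective)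
  let W : Matrix (Fin m) _ ℝ := fun i => π (Pi.single i 1)
  have hW : IsRepresentation N.dual W := fun S => by
    refine (hV.dual_indep_iff hE S).trans ?_
    rw [show LinearMap.range V.mulVecLin = LinearMap.ker π from hker.symm]
    exact (linearIndepOn_map_single_iff π S).symm
  refine ⟨_, W, hW.eRank_eq hE ?_, hW⟩
  refine eq_top_iff.2 fun w _ => ?_
  obtain ⟨y, rfl⟩ := LinearMap.range_eq_top.1 hsurj w
  rw [map_eq_sum_smul_map_single π y]
  exact Submodule.sum_mem _ fun i _ => Submodule.smul_mem _ _ (Submodule.subset_span ⟨i, rfl⟩)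

end DualRepresentation

section Unbalance

variable {m : ℕ} {N : Matroid (Fin m)}

lemma le_unbalance_mul {x : EReal} {K : ℝ} (hK : 0 < K)
    (hN : ∃ (k : ℕ) (V : Matrix (Fin m) (Fin k) ℝ), N.eRank = k ∧ IsRepresentation N V)
    (h : ∀ (k : ℕ) (V : Matrix (Fin m) (Fin k) ℝ), N.eRank = k → IsRepresentation N V →
      x ≤ (matrixUnbalance (bases N) V * K : ℝ)) :
    x ≤ (unbalance N * K : ℝ) := by
  obtain ⟨k₀, V₀, hr₀, hV₀⟩ := hN
  induction x with
  | bot => exact bot_le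
  | top => exact absurd (h k₀ V₀ hr₀ hV₀) (EReal.coe_lt_top _).not_ge
  | coe x =>
    rw [EReal.coe_le_coe_iff, ← div_le_iff₀ hK]
    refine le_csInf ⟨_, k₀, V₀, hr₀, hV₀, rfl⟩ ?_
    rintro _ ⟨k, V, hr, hV, rfl⟩
    rw [div_le_iff₀ hK]
    exact EReal.coe_le_coe_iff.1 (h k V hr hV)

theorem approxRatio_le_of_isRealLinear {n : ℕ} {M : Matroid (Fin m)} (hE : M.E = Set.univ)
    (hn : ∀ S ∈ bases M, S.card = n) (hM : IsRealLinear M) :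
    approxRatio n (bases M) ≤ (unbalance M.dual * ((m : ℝ) ^ m / m.factorial) : ℝ) ∧
      approxRatioLin n (bases M) ≤ (unbalance M.dual * 2 ^ m : ℝ) := by
  obtain ⟨d, V, hV⟩ := hM
  have hm : (0 : ℝ) < (m : ℝ) ^ m / m.factorial :=
    div_pos (by exact_mod_cast Nat.pow_self_pos) (by exact_mod_cast m.factorial_pos)
  exact ⟨le_unbalance_mul hm (hV.exists_dual hE) fun _ _ hr hW => (hW.approxRatio_le hE hn hr).1,
    le_unbalance_mul (by positivity) (hV.exists_dual hE) fun _ _ hr hW =>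
      (hW.approxRatio_le hE hn hr).2⟩

end Unbalance

open scoped Finset

section WeightedMeans

lemma pow_mul_prod_rpow_le {ι : Type*} (s : Finset ι) {η z : ι → ℝ} {c : ℕ}
    (hη0 : ∀ i ∈ s, 0 ≤ η i) (hη1 : ∀ i ∈ s, η i ≤ 1) (hsum : ∑ i ∈ s, η i = c)
    (hz : ∀ i ∈ s, 0 ≤ z i) :
    (c : ℝ) ^ c * ∏ i ∈ s, z i ^ η i ≤ (∑ i ∈ s, z i) ^ c := by
  rcases c.eq_zero_or_pos with rfl | hc
  · rw [Nat.cast_zero, Finset.sum_eq_zero_iff_of_nonneg hη0] at hsum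
    rw [Finset.prod_eq_one fun i hi => by rw [hsum i hi, Real.rpow_zero]]
    simp
  have hc0 : (0 : ℝ) < c := Nat.cast_pos.2 hc
  have hamgm := Real.geom_mean_le_arith_mean_weighted s (fun i => η i / c) z
    (fun i hi => div_nonneg (hη0 i hi) hc0.le) (by rw [← Finset.sum_div, hsum, div_self hc0.ne']) hz
  have hprod : ∏ i ∈ s, z i ^ η i = (∏ i ∈ s, z i ^ (η i / c)) ^ c := by
    rw [← Finset.prod_pow]
    refine Finset.prod_congr rfl fun i hi => ?_
    rw [← Real.rpow_mul_natCast (hz i hi), div_mul_cancel₀ _ hc0.ne']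
  rw [hprod, ← mul_pow]
  refine pow_le_pow_left₀ (mul_nonneg hc0.le
    (Finset.prod_nonneg fun i hi => Real.rpow_nonneg (hz i hi) _)) ?_ _
  calc (c : ℝ) * ∏ i ∈ s, z i ^ (η i / c) ≤ c * ∑ i ∈ s, η i / c * z i :=
        mul_le_mul_of_nonneg_left hamgm hc0.le
    _ = ∑ i ∈ s, η i * z i := by
        rw [Finset.mul_sum]
        exact Finset.sum_congr rfl fun i _ => by field_simp
    _ ≤ ∑ i ∈ s, z i :=
        Finset.sum_le_sum fun i hi => mul_le_of_le_one_left (hz i hi) (hη1 i hi)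

lemma prod_sqrt_le_rpow {ι : Type*} [Fintype ι] {x : ι → ℝ} (hx : ∀ i, 0 ≤ x i) :
    ∏ i, √(x i) ≤ ((∑ i, x i) / Fintype.card ι) ^ ((Fintype.card ι : ℝ) / 2) := by
  rcases isEmpty_or_nonempty ι with hι | hι
  · simp
  have hcard : (0 : ℝ) < Fintype.card ι := Nat.cast_pos.2 Fintype.card_pos
  have hamgm := Real.geom_mean_le_arith_mean_weighted Finset.univ
    (fun _ : ι => (1 : ℝ) / Fintype.card ι) x (fun _ _ => by positivity)
    (by simp [hcard.ne']) fun i _ => hx i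
  rw [← Finset.mul_sum, one_div_mul_eq_div] at hamgm
  calc ∏ i, √(x i) = (∏ i, x i ^ ((1 : ℝ) / Fintype.card ι)) ^ ((Fintype.card ι : ℝ) / 2) := by
        rw [← Real.finsetProd_rpow _ _ fun i _ => Real.rpow_nonneg (hx i) _]
        refine Finset.prod_congr rfl fun i _ => ?_
        rw [← Real.rpow_mul (hx i), Real.sqrt_eq_rpow]
        congr 1
        field_simp
    _ ≤ _ := Real.rpow_le_rpow (Finset.prod_nonneg fun i _ => Real.rpow_nonneg (hx i) _) hamgm
        (by positivity)

lemma factorial_div_pow_le (c : ℕ) :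
    (c.factorial : ℝ) / (c : ℝ) ^ c ≤ Real.exp (1 - c) * √(max c 1) := by
  rcases c with _ | k
  · simp
  have hstirling : Stirling.stirlingSeq (k + 1) ≤ Stirling.stirlingSeq 1 :=
    Stirling.stirlingSeq'_antitone (Nat.zero_le k)
  rw [Stirling.stirlingSeq_one, Stirling.stirlingSeq] at hstirling
  have hk : (1 : ℝ) ≤ ((k + 1 : ℕ) : ℝ) := by exact_mod_cast Nat.succ_pos k
  set x : ℝ := ((k + 1 : ℕ) : ℝ) with hx
  rw [div_le_iff₀ (by positivity), Real.sqrt_mul (by norm_num), div_pow] at hstirling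
  rw [max_eq_left hk, div_le_iff₀ (by positivity)]
  refine hstirling.trans (le_of_eq ?_)
  rw [Real.exp_sub, ← Real.exp_nat_mul, mul_one, ← hx]
  field_simp

theorem pow_div_factorial_mul_prod_le {ι : Type*} [Fintype ι] {s b : ι → ℕ}
    (hs : ∀ j, 1 ≤ s j) (hbs : ∀ j, b j ≤ s j) {m n : ℕ} (hm : ∑ j, s j = m) (hn : ∑ j, b j = n) :
    (m : ℝ) ^ m / m.factorial *
        ∏ j, (((s j - b j).factorial : ℝ) / ((s j - b j : ℕ) : ℝ) ^ (s j - b j)) ≤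
      Real.exp (n + Fintype.card ι) *
        ((m : ℝ) / Fintype.card ι) ^ ((Fintype.card ι : ℝ) / 2) := by
  have hm' : ∑ j, (s j : ℝ) = m := by exact_mod_cast hm
  have hn' : ∑ j, (b j : ℝ) = n := by exact_mod_cast hn
  have hfactor : ∀ j, ((s j - b j).factorial : ℝ) / ((s j - b j : ℕ) : ℝ) ^ (s j - b j) ≤
      Real.exp (1 - (s j - b j)) * √(s j) := fun j => by
    refine (factorial_div_pow_le _).trans ?_
    rw [Nat.cast_sub (hbs j)]
    gcongr
    exact max_le (sub_le_self _ (Nat.cast_nonneg _)) (by exact_mod_cast hs j)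
  have hexponent : (m : ℝ) + ∑ j, (1 - ((s j : ℝ) - b j)) = n + Fintype.card ι := by
    rw [Finset.sum_sub_distrib, Finset.sum_sub_distrib, hm', hn']
    simp
    ring
  calc _ ≤ Real.exp m * ∏ j, (Real.exp (1 - (s j - b j)) * √(s j)) :=
        mul_le_mul (Real.pow_div_factorial_le_exp _ m.cast_nonneg m)
          (Finset.prod_le_prod (fun j _ => by positivity) fun j _ => hfactor j)
          (Finset.prod_nonneg fun j _ => by positivity) (Real.exp_pos _).le
    _ = Real.exp (n + Fintype.card ι) * ∏ j, √(s j : ℝ) := by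
        rw [Finset.prod_mul_distrib, ← Real.exp_sum, ← mul_assoc, ← Real.exp_add, hexponent]
    _ ≤ _ := by
        gcongr
        rw [← hm']
        exact prod_sqrt_le_rpow fun j => Nat.cast_nonneg _

end WeightedMeans

section BlockPoly

lemma coeff_sqfreeExp_mul_X {m : ℕ} (f : MvPolynomial (Fin m) ℝ) (S : Finset (Fin m)) (i : Fin m) :
    coeff (sqfreeExp S) (f * X i) = if i ∈ S then coeff (sqfreeExp (S.erase i)) f else 0 := by
  have hsupp : i ∈ (sqfreeExp S).support ↔ i ∈ S := by simp [sqfreeExp_apply]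
  rw [coeff_mul_X', if_congr hsupp rfl rfl]
  split_ifs with hi
  · congr 1
    ext k
    by_cases hk : i = k
    · subst hk
      simp [sqfreeExp_apply, hi]
    · simp [sqfreeExp_apply, Ne.symm hk]
  · rfl

lemma card_erase_fiber_iff {σ κ : Type*} [DecidableEq σ] [DecidableEq κ] {J : σ → κ} {S : Finset σ}
    {c : κ → ℕ} {i : σ} (hi : i ∈ S) :
    (∀ j, #{k ∈ S.erase i | J k = j} = c j) ↔
      ∀ j, #{k ∈ S | J k = j} = (c + Pi.single (J i) 1 : κ → ℕ) j := by
  refine forall_congr' fun j => ?_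
  rw [Finset.filter_erase]
  by_cases hj : J i = j
  · subst hj
    have hmem : i ∈ S.filter fun k => J k = J i := Finset.mem_filter.2 ⟨hi, rfl⟩
    have hpos := Finset.card_pos.2 ⟨i, hmem⟩
    rw [Finset.card_erase_of_mem hmem, Pi.add_apply, Pi.single_eq_same]
    omega
  · rw [Finset.erase_eq_of_notMem (by simp [hj]), Pi.add_apply, Pi.single_eq_of_ne (Ne.symm hj),
      add_zero]

variable {σ κ : Type*} [Fintype σ] [DecidableEq κ] [Fintype κ]

/-- The product of the powers `ℓ_j ^ c j`, where `ℓ_j` is the sum of the variables of colour `j`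
in the colouring `J`. This is the selector polynomial of a partition matroid. -/
def blockPoly (J : σ → κ) (c : κ → ℕ) : MvPolynomial σ ℝ :=
  ∏ j, (∑ i with J i = j, X i) ^ c j

lemma isHomogeneous_blockPoly (J : σ → κ) (c : κ → ℕ) :
    (blockPoly J c).IsHomogeneous (∑ j, c j) := by
  refine IsHomogeneous.prod _ _ _ fun j _ => ?_
  have hlin : (∑ i with J i = j, (X i : MvPolynomial σ ℝ)).IsHomogeneous 1 :=
    IsHomogeneous.sum _ _ _ fun i _ => isHomogeneous_X ℝ i
  simpa using hlin.pow (c j)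

lemma hurwitzStable_blockPoly {J : σ → κ} (hJ : Function.Surjective J) (c : κ → ℕ) :
    HurwitzStable (blockPoly J c) := by
  intro z hz
  rw [blockPoly, map_prod, Finset.prod_ne_zero_iff]
  intro j _
  rw [map_pow, map_sum]
  refine pow_ne_zero _ fun h => ?_
  have hre : ∑ i with J i = j, (z i).re = 0 := by simpa using congrArg Complex.re h
  obtain ⟨i, hi⟩ := hJ j
  exact (Finset.sum_pos (fun i _ => hz i) ⟨i, by simpa using hi⟩).ne' hre

lemma capacityGE_blockPoly {J : σ → κ} {c : κ → ℕ} {η : σ → ℝ} (hη0 : 0 ≤ η) (hη1 : η ≤ 1)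
    (hsum : ∀ j, ∑ i with J i = j, η i = c j) :
    CapacityGE (blockPoly J c) η (∏ j, (c j : ℝ) ^ c j) := by
  intro z hz
  rw [← Finset.prod_fiberwise Finset.univ J, ← Finset.prod_mul_distrib, blockPoly, map_prod]
  refine Finset.prod_le_prod (fun j _ => mul_nonneg (by positivity)
    (Finset.prod_nonneg fun i _ => Real.rpow_nonneg (hz i).le _)) fun j _ => ?_
  simpa using pow_mul_prod_rpow_le _ (fun i _ => hη0 i) (fun i _ => hη1 i) (hsum j)
    fun i _ => (hz i).le

lemma blockPoly_add_single (J : σ → κ) (c : κ → ℕ) (j : κ) :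
    blockPoly J (c + Pi.single j 1) = ∑ i with J i = j, blockPoly J c * X i := by
  rw [← Finset.mul_sum, blockPoly, blockPoly]
  simp only [Pi.add_apply, pow_add, Finset.prod_mul_distrib, Pi.single_apply, pow_ite, pow_one,
    pow_zero, Finset.prod_ite_eq', Finset.mem_univ, if_true]

lemma prod_factorial_add_single (c : κ → ℕ) (j : κ) :
    ∏ k, (((c + Pi.single j 1 : κ → ℕ) k).factorial : ℝ) =
      (c j + 1) * ∏ k, ((c k).factorial : ℝ) := by
  have hfactor : ∀ k, (((c + Pi.single j 1 : κ → ℕ) k).factorial : ℝ) =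
      (if k = j then (c j : ℝ) + 1 else 1) * (c k).factorial := fun k => by
    by_cases hk : k = j
    · subst hk
      simp [Nat.factorial_succ]
    · simp [hk]
  rw [Finset.prod_congr rfl fun k _ => hfactor k, Finset.prod_mul_distrib]
  simp

theorem coeff_sqfreeExp_blockPoly {m : ℕ} (J : Fin m → κ) (c : κ → ℕ) (S : Finset (Fin m)) :
    coeff (sqfreeExp S) (blockPoly J c) =
      if ∀ j, #{i ∈ S | J i = j} = c j then ∏ j, ((c j).factorial : ℝ) else 0 := by
  induction hN : ∑ j, c j generalizing c S with
  | zero =>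
    obtain rfl : c = 0 := funext fun j => Finset.sum_eq_zero_iff.1 hN j (Finset.mem_univ j)
    have hempty : (∀ j, #{i ∈ S | J i = j} = 0) ↔ S = ∅ := by
      refine ⟨fun h => Finset.eq_empty_of_forall_notMem fun i hi => ?_, by rintro rfl; simp⟩
      exact Finset.card_ne_zero_of_mem (Finset.mem_filter (p := (J · = J i)).2 ⟨hi, rfl⟩) (h (J i))
    have hzero : 0 = sqfreeExp S ↔ S = ∅ := by
      rw [eq_comm, ← sqfreeExp_injective.eq_iff (b := ∅)]
      simp [sqfreeExp]
    simp [-Finset.card_eq_zero, blockPoly, coeff_one, hempty, hzero]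
  | succ N ih =>
    obtain ⟨j, hj⟩ : ∃ j, c j ≠ 0 := by
      by_contra! h
      simp [h] at hN
    obtain ⟨c, rfl⟩ : ∃ d, c = d + Pi.single j 1 :=
      ⟨c - Pi.single j 1, (tsub_add_cancel_of_le (update_le_iff.2
        ⟨Nat.pos_of_ne_zero hj, fun _ _ => Nat.zero_le _⟩)).symm⟩
    have hsum : ∑ k, c k = N := by simpa [Finset.sum_add_distrib] using hN
    have hterm : ∀ i ∈ Finset.univ.filter fun i => J i = j,
        coeff (sqfreeExp S) (blockPoly J c * X i) = if i ∈ S then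
          if ∀ k, #{i ∈ S | J i = k} = (c + Pi.single j 1 : κ → ℕ) k then
            ∏ k, ((c k).factorial : ℝ) else 0 else 0 := fun i hi => by
      obtain rfl := (Finset.mem_filter.1 hi).2
      rw [coeff_sqfreeExp_mul_X, ih c _ hsum]
      refine ite_congr rfl (fun hiS => ?_) fun _ => rfl
      exact if_congr (card_erase_fiber_iff hiS) rfl rfl
    rw [blockPoly_add_single, coeff_sum, Finset.sum_congr rfl hterm, Finset.sum_ite_mem,
      Finset.sum_const, nsmul_eq_mul, prod_factorial_add_single, Finset.filter_inter,
      Finset.univ_inter]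
    split_ifs with h
    · rw [h j]
      simp
    · simp

end BlockPoly

section FiberAvg

/-- The average of `w` over the elements of colour `j` in the colouring `K`; it is `0` if there are
none. -/
def fiberAvg {τ κ A : Type*} [Fintype τ] [DecidableEq κ] [AddCommMonoid A] [Module ℝ A]
    (K : τ → κ) (w : τ → A) (j : κ) : A :=
  (#{k | K k = j} : ℝ)⁻¹ • ∑ k with K k = j, w k

/-- The polynomial obtained from `g` by replacing every variable by the average of the new variables
of the same colour. This turns a capacity at an exponent with prescribed sums over the colours into
a capacity at the all-ones exponent. -/
def averagedPoly {σ τ κ : Type*} [Fintype τ] [DecidableEq κ] (J : σ → κ) (K : τ → κ)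
    (g : MvPolynomial σ ℝ) : MvPolynomial τ ℝ :=
  aeval (fun i => fiberAvg K X (J i)) g

lemma re_fiberAvg {τ κ : Type*} [Fintype τ] [DecidableEq κ] (K : τ → κ) (w : τ → ℂ) (j : κ) :
    (fiberAvg K w j).re = fiberAvg K (fun k => (w k).re) j := by
  rw [fiberAvg, Complex.smul_re, Complex.re_sum, fiberAvg]

lemma fiberAvg_nonneg {τ κ : Type*} [Fintype τ] [DecidableEq κ] {K : τ → κ} {w : τ → ℝ}
    (hw : ∀ k, 0 ≤ w k) (j : κ) : 0 ≤ fiberAvg K w j :=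
  smul_nonneg (by positivity) (Finset.sum_nonneg fun k _ => hw k)

lemma prod_fiber_le_fiberAvg_pow {τ κ : Type*} [Fintype τ] [DecidableEq κ] {K : τ → κ} {w : τ → ℝ}
    (hw : ∀ k, 0 ≤ w k) (j : κ) :
    ∏ k with K k = j, w k ≤ fiberAvg K w j ^ #{k | K k = j} := by
  have hamgm := pow_mul_prod_rpow_le (Finset.univ.filter (K · = j)) (c := #{k | K k = j})
    (η := 1) (z := w) (fun _ _ => zero_le_one) (fun _ _ => le_rfl) (by simp) fun k _ => hw k
  have hpos : (0 : ℝ) < (#{k | K k = j} : ℝ) ^ #{k | K k = j} := by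
    exact_mod_cast Nat.pow_self_pos
  rw [fiberAvg, smul_pow, smul_eq_mul, inv_pow, ← div_eq_inv_mul, le_div_iff₀ hpos, mul_comm]
  simpa using hamgm

section AveragedPoly

variable {σ τ κ : Type*} [Fintype τ] [DecidableEq κ] {J : σ → κ} {K : τ → κ}
  {g : MvPolynomial σ ℝ} {c : ℝ}

lemma aeval_averagedPoly {A : Type*} [CommRing A] [Algebra ℝ A] (w : τ → A) :
    aeval w (averagedPoly J K g) = aeval (fun i => fiberAvg K w (J i)) g := by
  rw [averagedPoly, comp_aeval_apply]
  simp [fiberAvg]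

lemma isHomogeneous_averagedPoly {d : ℕ} (hg : g.IsHomogeneous d) :
    (averagedPoly J K g).IsHomogeneous d := by
  have hlin : ∀ i, (fiberAvg K (X : τ → MvPolynomial τ ℝ) (J i)).IsHomogeneous 1 := fun i => by
    rw [fiberAvg, smul_eq_C_mul]
    exact (IsHomogeneous.sum _ _ _ fun k _ => isHomogeneous_X ℝ k).C_mul _
  have haeval := hg.aeval _ hlin
  rwa [one_mul] at haeval

lemma prod_fiberAvg_X [Fintype κ] (J : σ → κ) (K : τ → κ) (S : Finset σ) :
    ∏ i ∈ S, fiberAvg K (X : τ → MvPolynomial τ ℝ) (J i) =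
      C (∏ j, (#{k | K k = j} : ℝ)⁻¹ ^ #{i ∈ S | J i = j}) *
        blockPoly K fun j => #{i ∈ S | J i = j} := by
  rw [← Finset.prod_fiberwise' S J, map_prod, blockPoly, ← Finset.prod_mul_distrib]
  refine Finset.prod_congr rfl fun j _ => ?_
  rw [Finset.prod_const, fiberAvg, smul_eq_C_mul, mul_pow, map_pow]

lemma coeff_prod_fiberAvg_X [Fintype κ] {n : ℕ} (J : σ → κ) (K : Fin n → κ) (S : Finset σ) :
    coeff (sqfreeExp Finset.univ) (∏ i ∈ S, fiberAvg K (X : Fin n → MvPolynomial (Fin n) ℝ) (J i)) =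
      if ∀ j, #{i ∈ S | J i = j} = #{k | K k = j} then
        ∏ j, ((#{k | K k = j}).factorial : ℝ) / (#{k | K k = j} : ℝ) ^ #{k | K k = j} else 0 := by
  rw [prod_fiberAvg_X, coeff_C_mul, coeff_sqfreeExp_blockPoly, mul_ite, mul_zero]
  refine ite_congr (by simp only [eq_comm]) (fun h => ?_) fun _ => rfl
  simp_rw [h, ← Finset.prod_mul_distrib, inv_pow, div_eq_inv_mul]

lemma HurwitzStable.averagedPoly {d : ℕ} (hg : HurwitzStable g) (hd : g.IsHomogeneous d)
    (hc : 0 < c) (hcap : CapacityGE (averagedPoly J K g) 1 c) :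
    HurwitzStable (averagedPoly J K g) := by
  intro w hw
  rw [aeval_averagedPoly, ← norm_pos_iff]
  calc 0 < c * ∏ k, (w k).re ^ (1 : τ → ℝ) k :=
        mul_pos hc (Finset.prod_pos fun k _ => Real.rpow_pos_of_pos (hw k) _)
    _ ≤ eval (fun k => (w k).re) (BCapacity.averagedPoly J K g) := hcap _ hw
    _ = eval (fun i => (fiberAvg K w (J i)).re) g := by
        simp_rw [re_fiberAvg, ← aeval_eq_eval, aeval_averagedPoly]
    _ ≤ ‖aeval (fun i => fiberAvg K w (J i)) g‖ :=
        (le_abs_self _).trans (hg.abs_eval_re_le_norm_aeval hd fun i => by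
          rw [re_fiberAvg]
          exact fiberAvg_nonneg (fun k => (hw k).le) _)

variable [Fintype σ]

lemma CapacityGE.mul_prod_rpow_le_of_nonneg {θ : σ → ℝ} (hg : CapacityGE g θ c) (hθ : 0 ≤ θ)
    {z : σ → ℝ} (hz : ∀ i, 0 ≤ z i) : c * ∏ i, z i ^ θ i ≤ eval z g := by
  have hleft : Continuous fun ε : ℝ => c * ∏ i, (z i + ε) ^ θ i :=
    continuous_const.mul (continuous_finsetProd _ fun i _ =>
      (Real.continuous_rpow_const (hθ i)).comp (continuous_const.add continuous_id))
  have hright : Continuous fun ε : ℝ => eval (fun i => z i + ε) g :=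
    (continuous_eval g).comp (by fun_prop)
  refine le_of_tendsto_of_tendsto
    ((hleft.tendsto' 0 _ (by simp)).mono_left (nhdsWithin_le_nhds (s := Set.Ioi 0)))
    ((hright.tendsto' 0 _ (by simp)).mono_left nhdsWithin_le_nhds) ?_
  filter_upwards [self_mem_nhdsWithin] with ε (hε : 0 < ε)
  exact hg _ fun i => add_pos_of_nonneg_of_pos (hz i) hε

lemma CapacityGE.averagedPoly [Finite κ] {θ : σ → ℝ} (hg : CapacityGE g θ c) (hc : 0 ≤ c)
    (hθ : 0 ≤ θ) (hsum : ∀ j, ∑ i with J i = j, θ i = #{k | K k = j}) :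
    CapacityGE (averagedPoly J K g) 1 c := by
  cases nonempty_fintype κ
  intro w hw
  have hw_nonneg : ∀ k, 0 ≤ w k := fun k => (hw k).le
  have havg : ∀ j, 0 ≤ fiberAvg K w j := fiberAvg_nonneg hw_nonneg
  have hblock : ∀ j, ∏ i with J i = j, fiberAvg K w (J i) ^ θ i =
      fiberAvg K w j ^ #{k | K k = j} := fun j => by
    rw [Finset.prod_congr rfl fun i hi => by rw [(Finset.mem_filter.1 hi).2],
      ← Real.rpow_sum_of_nonneg (havg j) fun i _ => hθ i, hsum, Real.rpow_natCast]
  calc c * ∏ k, w k ^ (1 : τ → ℝ) k = c * ∏ j, ∏ k with K k = j, w k := by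
        simp [Finset.prod_fiberwise]
    _ ≤ c * ∏ j, fiberAvg K w j ^ #{k | K k = j} := by
        refine mul_le_mul_of_nonneg_left (Finset.prod_le_prod (fun j _ =>
          Finset.prod_nonneg fun k _ => hw_nonneg k) fun j _ => ?_) hc
        exact prod_fiber_le_fiberAvg_pow hw_nonneg j
    _ = c * ∏ i, fiberAvg K w (J i) ^ θ i := by
        rw [← Finset.prod_fiberwise Finset.univ J, Finset.prod_congr rfl fun j _ => hblock j]
    _ ≤ eval (fun i => fiberAvg K w (J i)) g :=
        hg.mul_prod_rpow_le_of_nonneg hθ fun i => havg (J i)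
    _ = eval w (BCapacity.averagedPoly J K g) := by
        simp_rw [← aeval_eq_eval, aeval_averagedPoly]

end AveragedPoly

end FiberAvg

section PartitionFamily

variable {κ : Type*} [DecidableEq κ] [Fintype κ] {m n : ℕ} {J : Fin m → κ} {b : κ → ℕ}

/-- The bases of the partition matroid whose blocks are the colour classes of `J`, with
capacities `b`. -/
def partitionFamily (J : Fin m → κ) (b : κ → ℕ) : Finset (Finset (Fin m)) :=
  Finset.univ.filter fun S => ∀ j, #{i ∈ S | J i = j} = b j

lemma mem_partitionFamily {S : Finset (Fin m)} :
    S ∈ partitionFamily J b ↔ ∀ j, #{i ∈ S | J i = j} = b j := by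
  simp [partitionFamily]

lemma basePolytope_subset_Icc {m : ℕ} (B : Finset (Finset (Fin m))) :
    basePolytope B ⊆ Set.Icc 0 1 := by
  refine convexHull_min ?_ (convex_Icc 0 1)
  rintro _ ⟨S, -, rfl⟩
  constructor <;> intro i <;> by_cases hi : i ∈ S <;> simp [charVec, hi]

lemma sum_eq_of_mem_basePolytope {m k : ℕ} {B : Finset (Finset (Fin m))} {T : Finset (Fin m)}
    (hB : ∀ S ∈ B, #(T ∩ S) = k) {θ : Fin m → ℝ} (hθ : θ ∈ basePolytope B) :
    ∑ i ∈ T, θ i = k := by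
  have hlin : IsLinearMap ℝ fun η : Fin m → ℝ => ∑ i ∈ T, η i :=
    ⟨fun x y => Finset.sum_add_distrib, fun r x => (Finset.mul_sum _ _ _).symm⟩
  refine convexHull_min ?_ (convex_hyperplane hlin (k : ℝ)) hθ
  rintro _ ⟨S, hS, rfl⟩
  simp [charVec, Finset.sum_ite_mem, hB S hS]

lemma sum_fiber_eq_of_mem_basePolytope {θ : Fin m → ℝ}
    (hθ : θ ∈ basePolytope (partitionFamily J b)) (j : κ) : ∑ i with J i = j, θ i = b j := by
  refine sum_eq_of_mem_basePolytope (fun S hS => ?_) hθ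
  rw [← mem_partitionFamily.1 hS j, Finset.filter_inter, Finset.univ_inter]

lemma isSelector_blockPoly (hJ : Function.Surjective J) (hb : ∀ j, b j ≤ #{i | J i = j}) :
    IsSelector (partitionFamily J b) (blockPoly J fun j => #{i | J i = j} - b j)
      (∑ j, (#{i | J i = j} - b j)) (∏ j, ((#{i | J i = j} - b j).factorial : ℝ))
      (∏ j, ((#{i | J i = j} - b j : ℕ) : ℝ) ^ (#{i | J i = j} - b j)) := by
  have hmem : ∀ S : Finset (Fin m), (∀ j, #{i ∈ Sᶜ | J i = j} = #{i | J i = j} - b j) ↔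
      S ∈ partitionFamily J b := fun S => by
    rw [mem_partitionFamily]
    refine forall_congr' fun j => ?_
    have hsplit : #{i ∈ S | J i = j} + #{i ∈ Sᶜ | J i = j} = #{i | J i = j} := by
      rw [← Finset.card_union_of_disjoint
        (Finset.disjoint_filter_filter disjoint_compl_right), ← Finset.filter_union,
        Finset.union_compl]
    have hbj := hb j
    omega
  refine ⟨hurwitzStable_blockPoly hJ _, isHomogeneous_blockPoly J _, fun S hS => ?_,
    fun S hS => ?_, fun θ hθ => capacityGE_blockPoly ?_ ?_ fun j => ?_⟩
  · rw [coeff_sqfreeExp_blockPoly, if_pos ((hmem S).2 hS)]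
  · rw [coeff_sqfreeExp_blockPoly, if_neg (mt (hmem S).1 hS)]
  · exact sub_nonneg.2 (basePolytope_subset_Icc _ hθ).2
  · exact sub_le_self _ (basePolytope_subset_Icc _ hθ).1
  · simp [sum_fiber_eq_of_mem_basePolytope hθ, Nat.cast_sub (hb j)]

theorem approxRatio_partitionFamily_le (hJ : Function.Surjective J)
    (hb : ∀ j, b j ≤ #{i | J i = j}) :
    approxRatio (∑ j, b j) (partitionFamily J b) ≤
      ((m : ℝ) ^ m / m.factorial * ∏ j, ((#{i | J i = j} - b j).factorial : ℝ) /
        ((#{i | J i = j} - b j : ℕ) : ℝ) ^ (#{i | J i = j} - b j) : ℝ) := by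
  have hsum : ∑ j, b j + ∑ j, (#{i | J i = j} - b j) = m := by
    rw [← Finset.sum_add_distrib, Finset.sum_congr rfl fun j _ => Nat.add_sub_of_le (hb j),
      ← Finset.card_eq_sum_card_fiberwise fun i _ => Finset.mem_univ (J i), Finset.card_fin]
  have hpos : 0 < ∏ j, ((#{i | J i = j} - b j : ℕ) : ℝ) ^ (#{i | J i = j} - b j) :=
    Finset.prod_pos fun j _ => by exact_mod_cast Nat.pow_self_pos
  rw [Finset.prod_div_distrib, mul_comm]
  exact (isSelector_blockPoly hJ hb).approxRatio_le hsum (by positivity) hpos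

lemma exists_card_fiber_eq (hn : ∑ j, b j = n) : ∃ K : Fin n → κ, ∀ j, #{k | K k = j} = b j := by
  let e : (Σ j, Fin (b j)) ≃ Fin n := Fintype.equivFinOfCardEq (by simpa using hn)
  refine ⟨fun k => (e.symm k).1, fun j => ?_⟩
  rw [← Fintype.card_subtype, ← Fintype.card_fin (b j)]
  exact Fintype.card_congr ((e.symm.subtypeEquiv fun _ => Iff.rfl).trans (Equiv.sigmaSubtype j))

lemma Multiaffine.coeff_averagedPoly {g : MvPolynomial (Fin m) ℝ} (hg : Multiaffine g)
    {K : Fin n → κ} (hK : ∀ j, #{k | K k = j} = b j) :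
    coeff (sqfreeExp Finset.univ) (averagedPoly J K g) =
      (∏ j, ((b j).factorial : ℝ) / (b j : ℝ) ^ b j) * famCoeff (partitionFamily J b) g := by
  rw [averagedPoly, hg.eq_genPoly, aeval_genPoly, coeff_sum, ← hg.eq_genPoly, famCoeff,
    partitionFamily, Finset.sum_filter, Finset.mul_sum]
  refine Finset.sum_congr rfl fun S _ => ?_
  rw [algebraMap_eq, coeff_C_mul, coeff_prod_fiberAvg_X]
  simp [hK, mul_comm]

theorem approxRatioLin_partitionFamily_le (hn : ∑ j, b j = n) :
    approxRatioLin n (partitionFamily J b) ≤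
      ((n : ℝ) ^ n / n.factorial * ∏ j, ((b j).factorial : ℝ) / (b j : ℝ) ^ b j : ℝ) := by
  refine approxRatioLin_le (by positivity) fun g _ hlin hstable hhom θ hθ c hc hcap => ?_
  obtain ⟨K, hK⟩ := exists_card_fiber_eq hn
  have hcapAvg : CapacityGE (averagedPoly J K g) 1 c :=
    hcap.averagedPoly hc.le (basePolytope_subset_Icc _ hθ).1 fun j => by
      rw [sum_fiber_eq_of_mem_basePolytope hθ, hK]
  rw [mul_assoc, ← hlin.coeff_averagedPoly hK]
  exact (hstable.averagedPoly hhom hc hcapAvg).le_mul_coeff (isHomogeneous_averagedPoly hhom) hc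
    hcapAvg

end PartitionFamily

section PartitionMatroid

variable {m n p : ℕ} {M : Matroid (Fin m)} {P : Fin p → Finset (Fin m)} {b : Fin p → ℕ}

namespace IsPartitionMatroid

lemma exists_colouring (hM : IsPartitionMatroid M P b) : ∃ J : Fin m → Fin p,
    Function.Surjective J ∧ (P = fun j => ({i | J i = j} : Finset (Fin m))) ∧
      bases M = partitionFamily J b := by
  choose J hJ using hM.cover
  have hmem : ∀ i j, i ∈ P j ↔ J i = j := fun i j => by
    refine ⟨fun hi => ?_, fun h => h ▸ hJ i⟩
    by_contra hne
    exact Finset.disjoint_left.1 (hM.disjoint _ _ hne) (hJ i) hi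
  refine ⟨J, fun j => ?_, ?_, ?_⟩
  · obtain ⟨i, hi⟩ := hM.nonempty j
    exact ⟨i, (hmem i j).1 hi⟩
  · ext j i
    simp [hmem]
  · ext S
    rw [mem_bases, hM.isBase_iff, mem_partitionFamily]
    simp_rw [← Finset.filter_mem_eq_inter, hmem]

lemma sum_eq (hM : IsPartitionMatroid M P b) (hn : ∀ S ∈ bases M, S.card = n) :
    ∑ j, b j = n := by
  obtain ⟨J, -, -, hB⟩ := hM.exists_colouring
  obtain ⟨S, hS⟩ := bases_nonempty M
  rw [← hn S hS, Finset.card_eq_sum_card_fiberwise fun i _ => Finset.mem_univ (J i)]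
  exact Finset.sum_congr rfl fun j _ => (mem_partitionFamily.1 (hB ▸ hS) j).symm

lemma sum_card (hM : IsPartitionMatroid M P b) : ∑ j, #(P j) = m := by
  obtain ⟨J, -, rfl, -⟩ := hM.exists_colouring
  rw [← Finset.card_eq_sum_card_fiberwise fun i _ => Finset.mem_univ (J i), Finset.card_fin]

theorem approxRatio_le (hM : IsPartitionMatroid M P b) (hn : ∀ S ∈ bases M, S.card = n) :
    approxRatio n (bases M) ≤
      ((m : ℝ) ^ m / m.factorial * ∏ j, ((#(P j) - b j).factorial : ℝ) /
        ((#(P j) - b j : ℕ) : ℝ) ^ (#(P j) - b j) : ℝ) := by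
  have hsum := hM.sum_eq hn
  obtain ⟨J, hJ, rfl, hB⟩ := hM.exists_colouring
  rw [hB, ← hsum]
  exact approxRatio_partitionFamily_le hJ hM.le_card

theorem bound_le (hM : IsPartitionMatroid M P b) (hn : ∀ S ∈ bases M, S.card = n) :
    (m : ℝ) ^ m / m.factorial * ∏ j, ((#(P j) - b j).factorial : ℝ) /
        ((#(P j) - b j : ℕ) : ℝ) ^ (#(P j) - b j) ≤
      Real.exp (n + p) * ((m : ℝ) / p) ^ ((p : ℝ) / 2) := by
  simpa using pow_div_factorial_mul_prod_le (fun j => Finset.card_pos.2 (hM.nonempty j))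
    hM.le_card hM.sum_card (hM.sum_eq hn)

theorem approxRatioLin_le (hM : IsPartitionMatroid M P b) (hn : ∀ S ∈ bases M, S.card = n) :
    approxRatioLin n (bases M) ≤
      ((n : ℝ) ^ n / n.factorial * ∏ j, ((b j).factorial : ℝ) / (b j : ℝ) ^ b j : ℝ) := by
  obtain ⟨J, -, -, hB⟩ := hM.exists_colouring
  rw [hB]
  exact approxRatioLin_partitionFamily_le (hM.sum_eq hn)

end IsPartitionMatroid

end PartitionMatroid

end BCapacity

end

theorem theorem2 {m n : ℕ} (M : Matroid (Fin m)) (hE : M.E = Set.univ)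
    (hn : ∀ S ∈ BCapacity.bases M, S.card = n) :
    -- strongly Rayleigh distributions on the bases of the dual matroid
    (∀ (μ : Finset (Fin m) → ℝ) (P : ℝ),
      BCapacity.IsStronglyRayleighOn (BCapacity.bases M.dual) μ →
      IsGreatest {r : ℝ | ∃ S ∈ BCapacity.bases M.dual, ∃ T ∈ BCapacity.bases M.dual,
        r = μ S / μ T} P →
      BCapacity.approxRatio n (BCapacity.bases M) ≤
          ((P * ((m : ℝ) ^ m / (m.factorial : ℝ)) : ℝ) : EReal) ∧
        BCapacity.approxRatioLin n (BCapacity.bases M) ≤ ((P * (2 : ℝ) ^ m : ℝ) : EReal)) ∧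
    -- linear matroids
    (BCapacity.IsRealLinear M →
      BCapacity.approxRatio n (BCapacity.bases M) ≤
          ((BCapacity.unbalance M.dual * ((m : ℝ) ^ m / (m.factorial : ℝ)) : ℝ) : EReal) ∧
        BCapacity.approxRatioLin n (BCapacity.bases M) ≤
          ((BCapacity.unbalance M.dual * (2 : ℝ) ^ m : ℝ) : EReal)) ∧
    -- partition matroids
    (∀ (p : ℕ) (P : Fin p → Finset (Fin m)) (b : Fin p → ℕ),
      BCapacity.IsPartitionMatroid M P b →
      BCapacity.approxRatio n (BCapacity.bases M) ≤
          (((m : ℝ) ^ m / (m.factorial : ℝ) *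
            ∏ j, ((((P j).card - b j).factorial : ℝ) /
              (((P j).card - b j : ℕ) : ℝ) ^ ((P j).card - b j)) : ℝ) : EReal) ∧
        (m : ℝ) ^ m / (m.factorial : ℝ) *
            ∏ j, ((((P j).card - b j).factorial : ℝ) /
              (((P j).card - b j : ℕ) : ℝ) ^ ((P j).card - b j)) ≤
          Real.exp ((n : ℝ) + (p : ℝ)) * ((m : ℝ) / (p : ℝ)) ^ ((p : ℝ) / 2) ∧
        BCapacity.approxRatioLin n (BCapacity.bases M) ≤
          (((n : ℝ) ^ n / (n.factorial : ℝ) *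
            ∏ j, (((b j).factorial : ℝ) / (b j : ℝ) ^ (b j)) : ℝ) : EReal)) :=
  ⟨fun _ _ hμ hP => hμ.approxRatio_le hE hn fun S hS T hT => hP.2 ⟨S, hS, T, hT, rfl⟩,
    fun hM => BCapacity.approxRatio_le_of_isRealLinear hE hn hM,
    fun _ _ _ hM => ⟨hM.approxRatio_le hn, hM.bound_le hn, hM.approxRatioLin_le hn⟩⟩
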